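/- Let $(X,J)=\{(X_n,J_n)\}_{n\ge 0}$ be a discrete-time Markov additive chain with level $X_n\in\mathbb{Z}$ and phase $J_n$ in a finite set $E$, with laws $\mathbb{P}_{x,i}=\mathbb{P}(\,\cdot\mid X_0=x,J_0=i)$: for every $T\ge 0$ and $j\in E$, given $\{J_T=j\}$, the process $\{(X_{T+n}-X_T,J_{T+n})\}_{n\ge0}$ is independent of $\sigma((X_k,J_k):k\le T)$ and has the law of $\{(X_n-X_0,J_n)\}_{n\ge0}$ given $J_0=j$. Put $\mathbf{P}_{ij}=\mathbb{P}(J_1=j\mid J_0=i)$ and $(\mathbf{A}_m)_{ij}=\mathbb{P}_{0,i}(X_1=m,\,J_1=j)$. Assume that $\mathbf{P}$ is irreducible and that the chain is upward skip-free, i.e. $\mathbf{A}_m=0$ for $m\ge 2$. Let $\boldsymbol{\pi}$ be the stationary distribution of $\mathbf{P}$, let $\mathbf{e}$ be the vector of ones, let $\mathbb{E}^{\boldsymbol{\pi}}(X_1)=\sum_{i}\pi_i\,\mathbb{E}(X_1\mid X_0=0,J_0=i)\in[-\infty,1]$, and let $\mathbf{F}(z)=\sum_{m=-1}^\infty z^m\mathbf{A}_{-m}$,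 on the set $D$ of those $z>0$ for which the series converges. Let $\kappa(z)$ be the Perron–Frobenius eigenvalue of $\mathbf{F}(z)$, i.e. the largest absolute value of its complex eigenvalues. Then $(0,1]\subseteq D$, for every $z\in D$ the number $\kappa(z)$ is itself an eigenvalue of $\mathbf{F}(z)$, and $\kappa$ has a derivative $\kappa'(1)\in(-\infty,+\infty]$ at $1$ within $D$ (that is, the left derivative if $D=(0,1]$, and the usual derivative if $D$ is a neighbourhood of $1$; the value $+\infty$ means that the difference quotients tend to $+\infty$, and is attained exactly when $\mathbb{E}^{\boldsymbol{\pi}}(X_1)=-\infty$). Moreover, $\mathbb{P}_{x,i}$-almost surely for every $x\in\mathbb{Z}$ and $i\in E$, $$\lim_{n\to\infty}\frac{X_n}{n}=-\kappa'(1)=\mathbb{E}^{\boldsymbol{\pi}}(X_1)=-\boldsymbol{\pi}^\top\sum_{m=-1}^\infty m\,\mathbf{A}_{-m}\mathbf{e},$$ as an identity in $[-\infty,\infty)$. Furthermore, $\mathbb{P}_{x,i}$-almost surely for every $x\in\mathbb{Z}$ and $i\in E$: 1. if $\kappa'(1)<0$, i.e. $\boldsymbol{\pi}^\top\mathbf{A}_1\mathbf{e}>\sum_{m=1}^\infty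 m\,\boldsymbol{\pi}^\top\mathbf{A}_{-m}\mathbf{e}$, then $X_n\to+\infty$; 2. if $\kappa'(1)>0$, i.e. $\boldsymbol{\pi}^\top\mathbf{A}_1\mathbf{e}<\sum_{m=1}^\infty m\,\boldsymbol{\pi}^\top\mathbf{A}_{-m}\mathbf{e}$, then $X_n\to-\infty$; 3. if $\kappa'(1)=0$, i.e. $\boldsymbol{\pi}^\top\mathbf{A}_1\mathbf{e}=\sum_{m=1}^\infty m\,\boldsymbol{\pi}^\top\mathbf{A}_{-m}\mathbf{e}$, and the chain is not degenerate, then $X_n$ oscillates: $\limsup_{n}X_n=+\infty$ and $\liminf_{n}X_n=-\infty$. Here the chain is called degenerate if there is $g:E\to\mathbb{Z}$ with $X_1-X_0=g(J_1)-g(J_0)$ $\mathbb{P}_{0,i}$-almost surely for every $i\in E$. -/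

import Mathlib

open MeasureTheory Filter Topology Matrix
open scoped ENNReal

/-- A discrete-time Markov additive chain `(X, J)` with level `X n ∈ ℤ` and phase `J n ∈ E`,
together with its family of laws `law x i = ℙ(· | X₀ = x, J₀ = i)`. -/
structure MarkovAdditiveChain (Ω E : Type*) [MeasurableSpace Ω] [MeasurableSpace E] where
  /-- the level process -/
  X : ℕ → Ω → ℤ
  /-- the phase process -/
  J : ℕ → Ω → E
  /-- the law of the chain started from level `x` and phase `i` -/
  law : ℤ → E → Measure Ω
  measurable_X : ∀ n, Measurable (X n)
  measurable_J : ∀ n, Measurable (J n)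
  isProbabilityMeasure_law : ∀ x i, IsProbabilityMeasure (law x i)
  start : ∀ x i, ∀ᵐ ω ∂(law x i), X 0 ω = x ∧ J 0 ω = i
  /-- The Markov additive property: given `J_T = j`, the process `(X_{T+n} - X_T, J_{T+n})_n` is
  independent of the history `σ((X_k, J_k) : k ≤ T)`, with the law of `(X_n - X_0, J_n)_n` given
  `J_0 = j`. -/
  markov_additive : ∀ (x : ℤ) (i : E) (T : ℕ) (j : E) (B : Set Ω) (C : Set (ℕ → ℤ × E)),
    MeasurableSet[⨆ k ≤ T, MeasurableSpace.comap (fun ω => (X k ω, J k ω)) inferInstance] B →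
    MeasurableSet C →
    law x i (B ∩ {ω | J T ω = j} ∩ {ω | (fun n => (X (T + n) ω - X T ω, J (T + n) ω)) ∈ C}) =
      law x i (B ∩ {ω | J T ω = j}) * law 0 j {ω | (fun n => (X n ω - X 0 ω, J n ω)) ∈ C}

namespace MarkovAdditiveChain

variable {Ω E : Type*} [MeasurableSpace Ω] [MeasurableSpace E]

/-- The transition matrix `P` of the phase process, `P i j = ℙ(J₁ = j | J₀ = i)`. -/
noncomputable def P (M : MarkovAdditiveChain Ω E) : Matrix E E ℝ :=
  Matrix.of fun i j => (M.law 0 i).real {ω | M.J 1 ω = j}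

/-- The block `A_m`, `(A_m) i j = ℙ(X₁ = m, J₁ = j | X₀ = 0, J₀ = i)`. -/
noncomputable def A (M : MarkovAdditiveChain Ω E) (m : ℤ) : Matrix E E ℝ :=
  Matrix.of fun i j => (M.law 0 i).real {ω | M.X 1 ω = m ∧ M.J 1 ω = j}

/-- The chain is upward skip-free ("spectrally negative"): no upward jump exceeds one. -/
def IsUpwardSkipFree (M : MarkovAdditiveChain Ω E) : Prop :=
  ∀ m : ℤ, 2 ≤ m → M.A m = 0

/-- The matrix generating function `F(z) = ∑_{m ≥ -1} z ^ m A_{-m}` (with `m = k - 1`, `k ∈ ℕ`). -/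
noncomputable def F (M : MarkovAdditiveChain Ω E) (z : ℝ) : Matrix E E ℝ :=
  Matrix.of fun i j => ∑' k : ℕ, z ^ ((k : ℤ) - 1) * M.A (1 - (k : ℤ)) i j

/-- The set of the `z > 0` at which (all entries of) the series `F(z)` converge. -/
def domF (M : MarkovAdditiveChain Ω E) : Set ℝ :=
  {z | 0 < z ∧ ∀ i j, Summable fun k : ℕ => z ^ ((k : ℤ) - 1) * M.A (1 - (k : ℤ)) i j}

end MarkovAdditiveChain

/-- The Perron–Frobenius eigenvalue of a nonnegative square matrix: the largest absolute value of
its complex eigenvalues. -/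
noncomputable def perronFrobeniusEigenvalue {E : Type*} [Fintype E] [DecidableEq E]
    (B : Matrix E E ℝ) : ℝ :=
  (spectralRadius ℂ (B.map ((↑) : ℝ → ℂ))).toReal

/-- `π` is a stationary probability vector of the stochastic matrix `P`. -/
structure IsStationaryDistribution {E : Type*} [Fintype E] (P : Matrix E E ℝ) (π : E → ℝ) :
    Prop where
  nonneg : ∀ i, 0 ≤ π i
  sum_eq_one : ∑ i, π i = 1
  stationary : π ᵥ* P = π

/-- The expectation of `Y`, with values in `[-∞, ∞]`: `𝔼 Y⁺ - 𝔼 Y⁻`. It is only used for `Y`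
that are almost surely bounded above. -/
noncomputable def extExpectation {Ω : Type*} [MeasurableSpace Ω] (μ : Measure Ω) (Y : Ω → ℝ) :
    EReal :=
  ((∫⁻ ω, ENNReal.ofReal (Y ω) ∂μ : ℝ≥0∞) : EReal) -
    ((∫⁻ ω, ENNReal.ofReal (-Y ω) ∂μ : ℝ≥0∞) : EReal)

/-- `f` has derivative `d` at `x` within `s`, where the values `±∞` are allowed for `d`. -/
def HasExtDerivWithinAt (f : ℝ → ℝ) (d : EReal) (s : Set ℝ) (x : ℝ) : Prop :=
  Tendsto (fun y => ((slope f x y : ℝ) : EReal)) (𝓝[s \ {x}] x) (𝓝 d)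

/-- For a finite value this is Mathlib's notion of derivative. -/
theorem hasExtDerivWithinAt_coe_iff (f : ℝ → ℝ) (d : ℝ) (s : Set ℝ) (x : ℝ) :
    HasExtDerivWithinAt f (d : EReal) s x ↔ HasDerivWithinAt f d s x := by
  rw [hasDerivWithinAt_iff_tendsto_slope]
  exact EReal.tendsto_coe

namespace MarkovAdditiveChain

variable {Ω E : Type*} [MeasurableSpace Ω] [MeasurableSpace E]

/-- `κ(z)`, the Perron–Frobenius eigenvalue of `F(z)`. -/
noncomputable def κ [Fintype E] [DecidableEq E] (M : MarkovAdditiveChain Ω E) (z : ℝ) : ℝ :=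
  perronFrobeniusEigenvalue (M.F z)

/-- `𝔼^α(X₁) = ∑ i, α i * 𝔼(X₁ | X₀ = 0, J₀ = i)`, with values in `[-∞, ∞]`. -/
noncomputable def meanX₁ [Fintype E] (M : MarkovAdditiveChain Ω E) (α : E → ℝ) : EReal :=
  ∑ i, (α i : EReal) * extExpectation (M.law 0 i) (fun ω => (M.X 1 ω : ℝ))

/-- The sum `∑_{m ≥ 1} m πᵀ A_{-m} e` of nonnegative terms (the term `m = 0` vanishes). -/
noncomputable def meanDown [Fintype E] (M : MarkovAdditiveChain Ω E) (π : E → ℝ) : ℝ≥0∞ :=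
  ∑' m : ℕ, (m : ℝ≥0∞) * ENNReal.ofReal (π ⬝ᵥ (M.A (-(m : ℤ)) *ᵥ 1))

/-- `πᵀ A_1 e`. -/
noncomputable def meanUp [Fintype E] (M : MarkovAdditiveChain Ω E) (π : E → ℝ) : ℝ :=
  π ⬝ᵥ (M.A 1 *ᵥ 1)

/-- `πᵀ (∑_{m ≥ -1} m A_{-m}) e`, in `(-∞, ∞]`: the only negative term, `m = -1`, is split off. -/
noncomputable def driftSum [Fintype E] (M : MarkovAdditiveChain Ω E) (π : E → ℝ) : EReal :=
  (M.meanDown π : EReal) - (M.meanUp π : EReal)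

/-- The level is a deterministic function of the phase up to its starting point:
`X₁ - X₀ = g(J₁) - g(J₀)` almost surely, for some `g : E → ℤ`. -/
def IsDegenerate (M : MarkovAdditiveChain Ω E) : Prop :=
  ∃ g : E → ℤ, ∀ i, ∀ᵐ ω ∂(M.law 0 i), M.X 1 ω - M.X 0 ω = g (M.J 1 ω) - g (M.J 0 ω)

end MarkovAdditiveChain

/-!
Under the stationary phase law, recentring the path at time `1` is measure preserving, and by
irreducibility it is ergodic. The law of large numbers is thus Birkhoff's theorem for the first
increment, the value `-∞` being reached by truncating the increment from below.

For `κ'(1)`, let `v_z > 0` be the eigenvector of `F(z)` with `π · v_z = 1`. Since `π` is stationary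
for `F(1) = P`, one has exactly `κ(z) - 1 = π (F(z) - F(1)) v_z`, and `v_z → e` by compactness. So
the difference quotients of `κ` at `1` have the limit of those of `π F(z) e`, which may be `+∞`.

At zero drift the level cannot tend to `+∞`: by ergodicity the times from which the path stays
strictly above its current level would have a positive frequency, hence the level a positive speed.
So `liminf Xₙ` is either `-∞` almost surely or an integer almost surely. In the latter case consider
the probabilities that the chain started from level `0` and phase `j` has lower limit `z`. The
levels `z` where the maximal such probability is attained are translated by every step of the chain,
which makes it degenerate. The upper limit is the lower limit of the reflected chain.
-/

section PerronFrobenius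

variable {E : Type*}

theorem forall_mem_of_isIrreducible {R : Type*} [Ring R] [LinearOrder R] {B : Matrix E E R}
    (hB : B.IsIrreducible) {S : Set E} (hne : S.Nonempty)
    (hS : ∀ i ∈ S, ∀ j, 0 < B i j → j ∈ S) (j : E) : j ∈ S := by
  obtain ⟨i, hi⟩ := hne
  let _ : Quiver E := toQuiver B
  obtain ⟨p, -⟩ := hB.connected i j
  induction p with
  | nil => exact hi
  | cons _ e ih => exact hS _ ih _ e.down

theorem isIrreducible_of_pos_imp_pos {R : Type*} [Ring R] [LinearOrder R] {B C : Matrix E E R}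
    (hB : B.IsIrreducible) (hC : ∀ i j, 0 ≤ C i j) (h : ∀ i j, 0 < B i j → 0 < C i j) :
    C.IsIrreducible := by
  refine ⟨hC, fun i j => ?_⟩
  have exists_path : ∀ (k : E) (p : @Quiver.Path E (toQuiver B) i k),
      ∃ q : @Quiver.Path E (toQuiver C) i k,
        @Quiver.Path.length E (toQuiver C) i k q = @Quiver.Path.length E (toQuiver B) i k p := by
    intro k p
    induction p with
    | nil => exact ⟨@Quiver.Path.nil E (toQuiver C) i, rfl⟩
    | cons _ e ih =>
      obtain ⟨q, hq⟩ := ih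
      exact ⟨@Quiver.Path.cons E (toQuiver C) _ _ _ q ⟨h _ _ e.down⟩, congrArg (· + 1) hq⟩
  obtain ⟨p, hp⟩ := hB.connected i j
  obtain ⟨q, hq⟩ := exists_path j p
  exact ⟨q, hq.symm ▸ hp⟩

theorem eq_of_le_of_isIrreducible {R α : Type*} [Ring R] [LinearOrder R] [LinearOrder α] [Finite E]
    {B : Matrix E E R} (hB : B.IsIrreducible) {W : E → α} (hW : ∀ i j, 0 < B i j → W i ≤ W j)
    (i j : E) : W i = W j := by
  have : Nonempty E := ⟨i⟩
  obtain ⟨m, hm⟩ := Finite.exists_max W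
  have hmax := forall_mem_of_isIrreducible hB (S := {k | W k = W m}) ⟨m, rfl⟩
    fun a ha b hab => le_antisymm (hm b) (ha.ge.trans (hW a b hab))
  exact (hmax i).trans (hmax j).symm

variable [Fintype E]

namespace IsStationaryDistribution

variable {P : Matrix E E ℝ} {π : E → ℝ}

theorem nonempty (hπ : IsStationaryDistribution P π) : Nonempty E := by
  by_contra hE
  have := not_nonempty_iff.1 hE
  simpa using hπ.sum_eq_one

theorem pos (hπ : IsStationaryDistribution P π) (hP : P.IsIrreducible) (j : E) : 0 < π j := by
  refine forall_mem_of_isIrreducible hP (S := {j | 0 < π j}) ?_ (fun i hi j hij => ?_) j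
  · obtain ⟨i, -, hi⟩ := Finset.exists_ne_zero_of_sum_ne_zero (hπ.sum_eq_one.trans_ne one_ne_zero)
    exact ⟨i, (hπ.nonneg i).lt_of_ne' hi⟩
  · change 0 < π j
    rw [← hπ.stationary]
    exact Finset.sum_pos' (fun k _ => mul_nonneg (hπ.nonneg k) (hP.nonneg k j))
      ⟨i, Finset.mem_univ i, mul_pos hi hij⟩

theorem eigenvalue_sub_one_mul (hπ : IsStationaryDistribution P π) {B : Matrix E E ℝ} {v : E → ℝ}
    {r : ℝ} (h : B *ᵥ v = r • v) : (r - 1) * (π ⬝ᵥ v) = π ⬝ᵥ ((B - P) *ᵥ v) := by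
  rw [sub_mulVec, dotProduct_sub, h, dotProduct_mulVec π P v, hπ.stationary, dotProduct_smul,
    smul_eq_mul, sub_one_mul]

end IsStationaryDistribution

-- The maximum principle: the maximum of a subharmonic `u` propagates along positive entries.
theorem eq_of_le_mulVec_of_isIrreducible {P : Matrix E E ℝ} (hP : P.IsIrreducible)
    (hP1 : P *ᵥ 1 = 1) {u : E → ℝ} (hu : u ≤ P *ᵥ u) (i j : E) : u i = u j := by
  have : Nonempty E := ⟨i⟩
  obtain ⟨m, hm⟩ := Finite.exists_max u
  have hmax := forall_mem_of_isIrreducible hP (S := {k | u k = u m}) ⟨m, rfl⟩ fun a ha b hab => by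
    by_contra hb
    have hlt : (P *ᵥ u) a < (P *ᵥ (u m • 1)) a :=
      Finset.sum_lt_sum
        (fun c _ => mul_le_mul_of_nonneg_left (by simpa using hm c) (hP.nonneg a c))
        ⟨b, Finset.mem_univ b,
          mul_lt_mul_of_pos_left (by simpa using lt_of_le_of_ne (hm b) hb) hab⟩
    rw [mulVec_smul, hP1] at hlt
    have hle : u a ≤ (P *ᵥ u) a := hu a
    rw [Set.mem_ofPred_eq] at ha
    simp only [Pi.smul_apply, Pi.one_apply, smul_eq_mul, mul_one] at hlt
    linarith
  exact (hmax i).trans (hmax j).symm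

theorem mulVec_pos_of_pos {S : Matrix E E ℝ} (hS : ∀ i j, 0 < S i j) {w : E → ℝ}
    (hw : 0 ≤ w) (hw0 : w ≠ 0) (i : E) : 0 < (S *ᵥ w) i := by
  obtain ⟨j, hj⟩ := Function.ne_iff.1 hw0
  exact Finset.sum_pos' (fun k _ => mul_nonneg (hS i k).le (hw k))
    ⟨j, Finset.mem_univ j, mul_pos (hS i j) (lt_of_le_of_ne (hw j) hj.symm)⟩

theorem exists_pos_commute_of_isIrreducible {B : Matrix E E ℝ} (hB : B.IsIrreducible) :
    ∃ S : Matrix E E ℝ, (∀ i j, 0 < S i j) ∧ Commute S B := by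
  classical
  choose k _ hk using (isIrreducible_iff_exists_pow_pos hB.nonneg).1 hB
  refine ⟨∑ a, ∑ b, B ^ k a b, fun i j => ?_, Commute.sum_left _ _ _ fun a _ =>
    Commute.sum_left _ _ _ fun b _ => (Commute.refl B).pow_left _⟩
  have hnonneg : ∀ a b, 0 ≤ (B ^ k a b) i j := fun a b => pow_apply_nonneg hB.nonneg _ i j
  simp only [Matrix.sum_apply]
  exact Finset.sum_pos' (fun a _ => Finset.sum_nonneg fun b _ => hnonneg a b)
    ⟨i, Finset.mem_univ i,
      Finset.sum_pos' (fun b _ => hnonneg i b) ⟨j, Finset.mem_univ j, hk i j⟩⟩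

section CollatzWielandt

variable [Nonempty E]

/-- The Collatz–Wielandt function `minᵢ (B y)ᵢ / yᵢ` of a matrix at a positive vector. The positive
eigenvector of an irreducible matrix is found by maximising it. -/
noncomputable def collatzWielandt (B : Matrix E E ℝ) (y : E → ℝ) : ℝ :=
  Finset.univ.inf' Finset.univ_nonempty fun i => (B *ᵥ y) i / y i

theorem collatzWielandt_smul (B : Matrix E E ℝ) (y : E → ℝ) {c : ℝ} (hc : c ≠ 0) :
    collatzWielandt B (c • y) = collatzWielandt B y := by
  simp only [collatzWielandt, mulVec_smul, Pi.smul_apply, smul_eq_mul, mul_div_mul_left _ _ hc]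

theorem continuousOn_collatzWielandt (B : Matrix E E ℝ) :
    ContinuousOn (collatzWielandt B) {y | ∀ i, 0 < y i} := by
  refine ContinuousOn.finset_inf'_apply _ fun i _ => ContinuousOn.div ?_ ?_ fun y hy => (hy i).ne'
  · exact ((continuous_apply i).comp
      (Continuous.matrix_mulVec continuous_const continuous_id)).continuousOn
  · exact (continuous_apply i).continuousOn

theorem collatzWielandt_mul_le {B : Matrix E E ℝ} {y : E → ℝ} (hy : ∀ i, 0 < y i) (i : E) :
    collatzWielandt B y * y i ≤ (B *ᵥ y) i :=
  (le_div_iff₀ (hy i)).1 (Finset.inf'_le _ (Finset.mem_univ i))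

theorem lt_collatzWielandt {B : Matrix E E ℝ} {y : E → ℝ} {t : ℝ} (hy : ∀ i, 0 < y i)
    (ht : ∀ i, t * y i < (B *ᵥ y) i) : t < collatzWielandt B y :=
  (Finset.lt_inf'_iff _).2 fun i _ => (lt_div_iff₀ (hy i)).2 (ht i)

theorem exists_pos_eigenvector_of_isIrreducible {B : Matrix E E ℝ} (hB : B.IsIrreducible) :
    ∃ (r : ℝ) (v : E → ℝ), (∀ i, 0 < v i) ∧ B *ᵥ v = r • v := by
  classical
  obtain ⟨S, hS, hSB⟩ := exists_pos_commute_of_isIrreducible hB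
  have hSpos : ∀ x ∈ stdSimplex ℝ E, ∀ i, 0 < (S *ᵥ x) i := fun x hx =>
    mulVec_pos_of_pos hS hx.1 (by rintro rfl; simpa using hx.2)
  obtain ⟨x, hx, hmax⟩ := (isCompact_stdSimplex ℝ E).exists_isMaxOn
    ⟨_, single_mem_stdSimplex ℝ (Classical.arbitrary E)⟩
    ((continuousOn_collatzWielandt B).comp
      (Continuous.matrix_mulVec continuous_const continuous_id).continuousOn hSpos)
  set v := S *ᵥ x
  have hv : ∀ i, 0 < v i := hSpos x hx
  have hvmax : collatzWielandt B (S *ᵥ v) ≤ collatzWielandt B v := by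
    have hsum : 0 < ∑ i, v i := Finset.sum_pos (fun i _ => hv i) Finset.univ_nonempty
    have hmem : (∑ i, v i)⁻¹ • v ∈ stdSimplex ℝ E :=
      ⟨fun i => mul_nonneg (inv_nonneg.2 hsum.le) (hv i).le, by
        simp only [Pi.smul_apply, smul_eq_mul, ← Finset.mul_sum, inv_mul_cancel₀ hsum.ne']⟩
    rw [← collatzWielandt_smul B (S *ᵥ v) (inv_pos.2 hsum).ne', ← mulVec_smul]
    exact hmax hmem
  refine ⟨collatzWielandt B v, v, hv, ?_⟩
  by_contra hne
  -- `S` turns the inequality `r • v ≤ B v`, `≠`, into a strict one, contradicting maximality.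
  have hgap := mulVec_pos_of_pos hS (w := B *ᵥ v - collatzWielandt B v • v)
    (fun i => sub_nonneg.2 (collatzWielandt_mul_le hv i)) (sub_ne_zero.2 hne)
  rw [mulVec_sub, mulVec_smul, mulVec_mulVec, hSB.eq, ← mulVec_mulVec] at hgap
  refine hvmax.not_gt (lt_collatzWielandt (fun i => ?_) fun i => sub_pos.1 (hgap i))
  exact mulVec_pos_of_pos hS (fun i => (hv i).le) (fun h => (hv (Classical.arbitrary E)).ne'
    (congrFun h _)) i

end CollatzWielandt

section PerronEigenvalue

variable [DecidableEq E]

theorem mem_spectrum_iff_exists_mulVec_eq_smul {𝕜 : Type*} [Field 𝕜] {B : Matrix E E 𝕜} {k : 𝕜} :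
    k ∈ spectrum 𝕜 B ↔ ∃ x : E → 𝕜, x ≠ 0 ∧ B *ᵥ x = k • x := by
  rw [← Matrix.spectrum_toLin', ← Module.End.hasEigenvalue_iff_mem_spectrum]
  constructor
  · intro hk
    obtain ⟨x, hx⟩ := hk.exists_hasEigenvector
    exact ⟨x, hx.2, by simpa using hx.apply_eq_smul⟩
  · rintro ⟨x, hx, hk⟩
    exact Module.End.hasEigenvalue_of_hasEigenvector
      (Module.End.hasEigenvector_iff.2 ⟨Module.End.mem_eigenspace_iff.2 (by simpa using hk), hx⟩)

variable {B : Matrix E E ℝ} {v : E → ℝ} {r : ℝ}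

-- At an index `m` maximising `‖x i‖ / v i` the triangle inequality gives `‖k‖ ‖x m‖ ≤ r ‖x m‖`.
theorem norm_le_of_mem_spectrum_of_pos_eigenvector (hB : ∀ i j, 0 ≤ B i j) (hv : ∀ i, 0 < v i)
    (h : B *ᵥ v = r • v) {k : ℂ} (hk : k ∈ spectrum ℂ (B.map ((↑) : ℝ → ℂ))) : ‖k‖ ≤ r := by
  obtain ⟨x, hx0, hx⟩ := mem_spectrum_iff_exists_mulVec_eq_smul.1 hk
  obtain ⟨a, ha⟩ := Function.ne_iff.1 hx0
  have : Nonempty E := ⟨a⟩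
  obtain ⟨m, hm⟩ := Finite.exists_max fun i => ‖x i‖ / v i
  set c := ‖x m‖ / v m
  have hxc : ∀ i, ‖x i‖ ≤ c * v i := fun i => (div_le_iff₀ (hv i)).1 (hm i)
  have hc0 : 0 < c := (div_pos (norm_pos_iff.2 ha) (hv a)).trans_le (hm a)
  have hxm : ‖x m‖ = c * v m := (div_mul_cancel₀ _ (hv m).ne').symm
  refine le_of_mul_le_mul_right ?_ (mul_pos hc0 (hv m))
  calc ‖k‖ * (c * v m) = ‖(k • x) m‖ := by rw [← hxm, Pi.smul_apply, norm_smul]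
    _ = ‖∑ j, (B m j : ℂ) * x j‖ := by rw [← hx]; rfl
    _ ≤ ∑ j, ‖(B m j : ℂ) * x j‖ := norm_sum_le _ _
    _ ≤ ∑ j, B m j * (c * v j) := Finset.sum_le_sum fun j _ => by
        rw [norm_mul, Complex.norm_real, Real.norm_of_nonneg (hB m j)]
        exact mul_le_mul_of_nonneg_left (hxc j) (hB m j)
    _ = (B *ᵥ (c • v)) m := rfl
    _ = r * (c * v m) := by
        rw [mulVec_smul, h, smul_comm, Pi.smul_apply, Pi.smul_apply, smul_eq_mul, smul_eq_mul]

theorem ofReal_mem_spectrum_of_mulVec_eq_smul (hv : v ≠ 0) (h : B *ᵥ v = r • v) :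
    (r : ℂ) ∈ spectrum ℂ (B.map ((↑) : ℝ → ℂ)) := by
  refine mem_spectrum_iff_exists_mulVec_eq_smul.2 ⟨fun i => (v i : ℂ), fun h0 => hv ?_, ?_⟩
  · exact funext fun i => Complex.ofReal_eq_zero.1 (congrFun h0 i)
  · ext i
    have hi := congrArg ((↑) : ℝ → ℂ) (congrFun h i)
    simpa [mulVec, dotProduct] using hi

theorem perronFrobeniusEigenvalue_eq [Nonempty E] (hB : ∀ i j, 0 ≤ B i j) (hv : ∀ i, 0 < v i)
    (h : B *ᵥ v = r • v) : perronFrobeniusEigenvalue B = r := by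
  have hmem := ofReal_mem_spectrum_of_mulVec_eq_smul
    (fun h0 => (hv (Classical.arbitrary E)).ne' (congrFun h0 _)) h
  have hr : ‖(r : ℂ)‖ = r := by
    have hr0 := (norm_nonneg _).trans (norm_le_of_mem_spectrum_of_pos_eigenvector hB hv h hmem)
    rw [Complex.norm_real, Real.norm_of_nonneg hr0]
  have hradius : spectralRadius ℂ (B.map ((↑) : ℝ → ℂ)) = ‖(r : ℂ)‖₊ :=
    le_antisymm (iSup₂_le fun k hk => ENNReal.coe_le_coe.2 <| NNReal.coe_le_coe.1 <|
      (norm_le_of_mem_spectrum_of_pos_eigenvector hB hv h hk).trans_eq hr.symm)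
      (le_iSup₂ (f := fun (k : ℂ) _ => (‖k‖₊ : ℝ≥0∞)) (r : ℂ) hmem)
  rw [perronFrobeniusEigenvalue, hradius, ENNReal.coe_toReal, coe_nnnorm, hr]

end PerronEigenvalue

theorem tendsto_dotProduct {ι : Type*} {l : Filter ι} {u v : ι → E → ℝ} {x y : E → ℝ}
    (hu : Tendsto u l (𝓝 x)) (hv : Tendsto v l (𝓝 y)) :
    Tendsto (fun z => u z ⬝ᵥ v z) l (𝓝 (x ⬝ᵥ y)) :=
  tendsto_finsetSum _ fun j _ => (tendsto_pi_nhds.1 hu j).mul (tendsto_pi_nhds.1 hv j)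

theorem tendsto_mulVec {ι : Type*} {l : Filter ι} {B : ι → Matrix E E ℝ} {P : Matrix E E ℝ}
    {v : ι → E → ℝ} {y : E → ℝ} (hB : Tendsto B l (𝓝 P)) (hv : Tendsto v l (𝓝 y)) :
    Tendsto (fun z => B z *ᵥ v z) l (𝓝 (P *ᵥ y)) :=
  tendsto_pi_nhds.2 fun i => tendsto_dotProduct (tendsto_pi_nhds.1 hB i) hv

section EigenvectorConvergence

variable {ι : Type*} {l : Filter ι} {P : Matrix E E ℝ} {π : E → ℝ} {B : ι → Matrix E E ℝ}
  {r : ι → ℝ} {v : ι → E → ℝ}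

theorem tendsto_eigenvalue {y : E → ℝ} (hπ : IsStationaryDistribution P π)
    (hB : Tendsto B l (𝓝 P)) (hv : Tendsto v l (𝓝 y)) (hπv : ∀ᶠ z in l, π ⬝ᵥ v z = 1)
    (h : ∀ᶠ z in l, B z *ᵥ v z = r z • v z) : Tendsto r l (𝓝 1) := by
  have hlim : Tendsto (fun z => π ⬝ᵥ ((B z - P) *ᵥ v z) + 1) l (𝓝 1) := by
    simpa only [sub_self, zero_mulVec, dotProduct_zero, zero_add] using
      (tendsto_dotProduct (tendsto_const_nhds (x := π))
        (tendsto_mulVec (hB.sub_const P) hv)).add_const 1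
  refine hlim.congr' ?_
  filter_upwards [hπv, h] with z hz hBz
  rw [← hπ.eigenvalue_sub_one_mul hBz, hz, mul_one, sub_add_cancel]

theorem tendsto_eigenvector (hP : P.IsIrreducible) (hP1 : P *ᵥ 1 = 1)
    (hπ : IsStationaryDistribution P π) (hB : Tendsto B l (𝓝 P)) (hv : ∀ᶠ z in l, 0 ≤ v z)
    (hπv : ∀ᶠ z in l, π ⬝ᵥ v z = 1) (h : ∀ᶠ z in l, B z *ᵥ v z = r z • v z) :
    Tendsto v l (𝓝 1) := by
  have hmem : ∀ᶠ z in l, v z ∈ Set.Icc 0 fun i => (π i)⁻¹ := by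
    filter_upwards [hv, hπv] with z hz hz1
    refine ⟨hz, fun i => (le_inv_mul_iff₀ (hπ.pos hP i)).2 ?_ |>.trans_eq (mul_one _)⟩
    rw [← hz1]
    exact Finset.single_le_sum (fun j _ => mul_nonneg (hπ.nonneg j) (hz j)) (Finset.mem_univ i)
  refine isCompact_Icc.tendsto_nhds_of_unique_mapClusterPt hmem fun y _ hy => ?_
  obtain ⟨U, hUl, hU⟩ := mapClusterPt_iff_ultrafilter.1 hy
  have hPy : P *ᵥ y = y := by
    have hr := tendsto_eigenvalue hπ (hB.mono_left hUl) hU (hUl hπv) (hUl h)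
    refine tendsto_nhds_unique ((tendsto_mulVec (hB.mono_left hUl) hU).congr' (hUl h)) ?_
    simpa only [one_smul] using hr.smul hU
  have hconst := eq_of_le_mulVec_of_isIrreducible hP hP1 hPy.ge
  have hπy : π ⬝ᵥ y = 1 := tendsto_nhds_unique
    ((tendsto_dotProduct tendsto_const_nhds hU).congr' (hUl hπv)) tendsto_const_nhds
  ext i
  rwa [show y = y i • 1 from funext fun j => by simpa using hconst j i, dotProduct_smul,
    dotProduct_one, hπ.sum_eq_one, smul_eq_mul, mul_one] at hπy

end EigenvectorConvergence

end PerronFrobenius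

section ErgodicTheorem

variable {α : Type*} {θ : α → α} {f : α → ℝ}

/-- The maximum `max 0 (S₁ x) ⋯ (Sₙ x)` of the first `n` Birkhoff sums of `f` and the empty one,
defined through the recursion `max 0 (f x + ·)` that drives the maximal ergodic theorem. -/
def birkhoffMax (θ : α → α) (f : α → ℝ) : ℕ → α → ℝ
  | 0 => fun _ => 0
  | n + 1 => fun x => max 0 (f x + birkhoffMax θ f n (θ x))

theorem birkhoffMax_nonneg (n : ℕ) (x : α) : 0 ≤ birkhoffMax θ f n x := by
  cases n with
  | zero => exact le_rfl
  | succ n => exact le_max_left _ _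

theorem monotone_birkhoffMax (x : α) : Monotone fun n => birkhoffMax θ f n x := by
  refine monotone_nat_of_le_succ fun n => ?_
  induction n generalizing x with
  | zero => exact le_max_left _ _
  | succ n ih => exact max_le_max le_rfl (add_le_add_right (ih _) _)

theorem birkhoffSum_le_birkhoffMax (n : ℕ) (x : α) :
    birkhoffSum θ f n x ≤ birkhoffMax θ f n x := by
  induction n generalizing x with
  | zero => exact le_rfl
  | succ n ih =>
    rw [birkhoffSum_succ']
    exact le_max_of_le_right (add_le_add_right (ih _) _)

theorem birkhoffMax_succ_sub_le_indicator (n : ℕ) (x : α) :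
    birkhoffMax θ f (n + 1) x - birkhoffMax θ f n (θ x) ≤
      {x | 0 < birkhoffMax θ f (n + 1) x}.indicator f x := by
  by_cases hx : 0 < birkhoffMax θ f (n + 1) x
  · rw [Set.indicator_of_mem (Set.mem_ofPred_eq ▸ hx), sub_le_iff_le_add]
    exact ((lt_max_iff.1 hx).resolve_left (lt_irrefl 0) |> max_eq_right_of_lt).le
  · rw [Set.indicator_of_notMem (s := {x | 0 < birkhoffMax θ f (n + 1) x}) hx]
    linarith [birkhoffMax_nonneg (θ := θ) (f := f) n (θ x), not_lt.1 hx]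

theorem bddAbove_range_birkhoffSum_apply_iff (x : α) :
    BddAbove (Set.range fun n => birkhoffSum θ f n (θ x)) ↔
      BddAbove (Set.range fun n => birkhoffSum θ f n x) := by
  simp only [bddAbove_def, Set.forall_mem_range]
  constructor
  · rintro ⟨K, hK⟩
    refine ⟨max 0 (f x + K), fun n => ?_⟩
    cases n with
    | zero => exact le_max_left _ _
    | succ n => exact birkhoffSum_succ' θ f n x ▸ le_max_of_le_right (add_le_add_right (hK n) _)
  · rintro ⟨K, hK⟩
    exact ⟨K - f x, fun n => le_sub_iff_add_le'.2 (birkhoffSum_succ' θ f n x ▸ hK (n + 1))⟩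

variable [MeasurableSpace α] {μ : Measure α}

theorem measurable_birkhoffMax (hθ : Measurable θ) (hf : Measurable f) (n : ℕ) :
    Measurable (birkhoffMax θ f n) := by
  induction n with
  | zero => exact measurable_const
  | succ n ih => exact measurable_const.max (hf.add (ih.comp hθ))

theorem measurable_birkhoffSum (hθ : Measurable θ) (hf : Measurable f) (n : ℕ) :
    Measurable (birkhoffSum θ f n) :=
  Finset.measurable_fun_sum _ fun k _ => hf.comp (hθ.iterate k)

theorem integrable_birkhoffMax (hθ : MeasurePreserving θ μ μ) (hi : Integrable f μ) (n : ℕ) :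
    Integrable (birkhoffMax θ f n) μ := by
  induction n with
  | zero => exact integrable_zero _ _ _
  | succ n ih => exact (integrable_zero _ _ _).sup (hi.add (hθ.integrable_comp_of_integrable ih))

theorem setIntegral_birkhoffMax_pos_nonneg (hθ : MeasurePreserving θ μ μ) (hf : Measurable f)
    (hi : Integrable f μ) (n : ℕ) : 0 ≤ ∫ x in {x | 0 < birkhoffMax θ f (n + 1) x}, f x ∂μ := by
  have hmeas := measurable_birkhoffMax hθ.measurable hf
  have hint := integrable_birkhoffMax hθ hi
  have hintθ := hθ.integrable_comp_of_integrable (hint n)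
  have hinv : ∫ x, birkhoffMax θ f n (θ x) ∂μ = ∫ x, birkhoffMax θ f n x ∂μ := by
    rw [← integral_map hθ.measurable.aemeasurable (hmeas n).aestronglyMeasurable, hθ.map_eq]
  calc 0 ≤ ∫ x, birkhoffMax θ f (n + 1) x ∂μ - ∫ x, birkhoffMax θ f n x ∂μ :=
        sub_nonneg.2 (integral_mono (hint n) (hint _) fun x => monotone_birkhoffMax x n.le_succ)
    _ = ∫ x, (birkhoffMax θ f (n + 1) x - birkhoffMax θ f n (θ x)) ∂μ := by
        rw [← hinv]; exact (integral_sub (hint _) hintθ).symm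
    _ ≤ ∫ x, {x | 0 < birkhoffMax θ f (n + 1) x}.indicator f x ∂μ :=
        integral_mono ((hint _).sub hintθ)
          (hi.indicator (measurableSet_lt measurable_const (hmeas _)))
          (birkhoffMax_succ_sub_le_indicator n)
    _ = ∫ x in {x | 0 < birkhoffMax θ f (n + 1) x}, f x ∂μ :=
        integral_indicator (measurableSet_lt measurable_const (hmeas _))

theorem integral_nonneg_of_ae_exists_birkhoffSum_pos (hθ : MeasurePreserving θ μ μ)
    (hf : Measurable f) (hi : Integrable f μ) (h : ∀ᵐ x ∂μ, ∃ n, 0 < birkhoffSum θ f n x) :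
    0 ≤ ∫ x, f x ∂μ := by
  set s : ℕ → Set α := fun n => {x | 0 < birkhoffMax θ f (n + 1) x}
  have hs : ∀ n, MeasurableSet (s n) := fun n =>
    measurableSet_lt measurable_const (measurable_birkhoffMax hθ.measurable hf _)
  have hmono : Monotone s := fun m n hmn x hx =>
    lt_of_lt_of_le hx (monotone_birkhoffMax x (Nat.succ_le_succ hmn))
  have hunion : (⋃ n, s n) =ᵐ[μ] Set.univ := by
    rw [eventuallyEq_univ]
    filter_upwards [h] with x ⟨n, hn⟩
    exact Set.mem_iUnion.2 ⟨n, (hn.trans_le (birkhoffSum_le_birkhoffMax n x)).trans_le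
      (monotone_birkhoffMax x n.le_succ)⟩
  have hlim := tendsto_setIntegral_of_monotone hs hmono hi.integrableOn
  rw [setIntegral_congr_set hunion, setIntegral_univ] at hlim
  exact ge_of_tendsto' hlim fun n => setIntegral_birkhoffMax_pos_nonneg hθ hf hi n

theorem ae_bddAbove_range_birkhoffSum (hθ : Ergodic θ μ) (hf : Measurable f) (hi : Integrable f μ)
    (hneg : ∫ x, f x ∂μ < 0) : ∀ᵐ x ∂μ, BddAbove (Set.range fun n => birkhoffSum θ f n x) := by
  refine (hθ.toPreErgodic.ae_mem_or_ae_notMem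
    (measurableSet_bddAbove_range (measurable_birkhoffSum hθ.measurable hf))
    (Set.ext bddAbove_range_birkhoffSum_apply_iff)).resolve_right fun hunbdd => hneg.not_ge ?_
  refine integral_nonneg_of_ae_exists_birkhoffSum_pos hθ.toMeasurePreserving hf hi ?_
  filter_upwards [hunbdd] with x hx
  by_contra! hcon
  exact hx ⟨0, Set.forall_mem_range.2 hcon⟩

theorem ae_eventually_birkhoffAverage_lt [IsProbabilityMeasure μ] (hθ : Ergodic θ μ)
    (hf : Measurable f) (hi : Integrable f μ) {c : ℝ} (hc : ∫ x, f x ∂μ < c) :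
    ∀ᵐ x ∂μ, ∀ᶠ n : ℕ in atTop, birkhoffAverage ℝ θ f n x < c := by
  obtain ⟨b, hb, hbc⟩ := exists_between hc
  have hneg : ∫ x, (f x - b) ∂μ < 0 := by
    simpa [integral_sub hi (integrable_const b)] using hb
  filter_upwards [ae_bddAbove_range_birkhoffSum hθ (hf.sub_const b) (hi.sub (integrable_const b))
    hneg] with x ⟨K, hK⟩
  have hlim : Tendsto (fun n : ℕ => b + K / n) atTop (𝓝 b) := by
    simpa using (tendsto_const_div_atTop_nhds_zero_nat K).const_add b
  filter_upwards [hlim.eventually_lt_const hbc, eventually_gt_atTop 0] with n hn hn0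
  have hn0' : (0 : ℝ) < n := Nat.cast_pos.2 hn0
  have hsum : birkhoffSum θ f n x - n * b ≤ K := by
    simpa [birkhoffSum] using Set.forall_mem_range.1 hK n
  refine lt_of_le_of_lt ?_ hn
  rw [birkhoffAverage, smul_eq_mul, inv_mul_le_iff₀ hn0', mul_add, mul_div_cancel₀ _ hn0'.ne']
  linarith

theorem ae_tendsto_birkhoffAverage [IsProbabilityMeasure μ] (hθ : Ergodic θ μ)
    (hf : Measurable f) (hi : Integrable f μ) :
    ∀ᵐ x ∂μ, Tendsto (fun n => birkhoffAverage ℝ θ f n x) atTop (𝓝 (∫ x, f x ∂μ)) := by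
  have hupper : ∀ᵐ x ∂μ, ∀ q : ℚ, ∫ x, f x ∂μ < q →
      ∀ᶠ n in atTop, birkhoffAverage ℝ θ f n x < q :=
    ae_all_iff.2 fun q => eventually_imp_distrib_left.2 fun hq =>
      ae_eventually_birkhoffAverage_lt hθ hf hi hq
  have hlower : ∀ᵐ x ∂μ, ∀ q : ℚ, q < ∫ x, f x ∂μ →
      ∀ᶠ n in atTop, q < birkhoffAverage ℝ θ f n x := by
    refine ae_all_iff.2 fun q => eventually_imp_distrib_left.2 fun hq => ?_
    have hneg : ∫ x, (-f) x ∂μ < -q := by simpa only [Pi.neg_apply, integral_neg, neg_lt_neg_iff]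
    filter_upwards [ae_eventually_birkhoffAverage_lt hθ hf.neg hi.neg hneg] with x hx
    simpa only [birkhoffAverage_neg, Pi.neg_apply, neg_lt_neg_iff] using hx
  filter_upwards [hupper, hlower] with x hux hlx
  refine tendsto_order.2 ⟨fun a ha => ?_, fun a ha => ?_⟩
  · obtain ⟨q, haq, hq⟩ := exists_rat_btwn ha
    exact (hlx q hq).mono fun n hn => haq.trans hn
  · obtain ⟨q, hq, hqa⟩ := exists_rat_btwn ha
    exact (hux q hq).mono fun n hn => hn.trans hqa

theorem integrable_of_lintegral_ofReal_ne_top (hf : Measurable f)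
    (hpos : ∫⁻ x, ENNReal.ofReal (f x) ∂μ ≠ ⊤) (hneg : ∫⁻ x, ENNReal.ofReal (-f x) ∂μ ≠ ⊤) :
    Integrable f μ := by
  refine ⟨hf.aestronglyMeasurable, (hasFiniteIntegral_iff_norm f).2 ?_⟩
  calc ∫⁻ x, ENNReal.ofReal ‖f x‖ ∂μ
      ≤ ∫⁻ x, (ENNReal.ofReal (f x) + ENNReal.ofReal (-f x)) ∂μ := lintegral_mono fun x => by
        rcases abs_choice (f x) with h | h <;> rw [Real.norm_eq_abs, h]
        exacts [le_self_add, le_add_self]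
    _ < ⊤ := by
        rw [lintegral_add_left hf.ennreal_ofReal]
        exact ENNReal.add_lt_top.2 ⟨hpos.lt_top, hneg.lt_top⟩

theorem extExpectation_eq_integral (hi : Integrable f μ) :
    extExpectation μ f = ((∫ x, f x ∂μ : ℝ) : EReal) := by
  rw [integral_eq_lintegral_pos_part_sub_lintegral_neg_part hi, extExpectation, EReal.coe_sub,
    EReal.coe_ennreal_toReal hi.lintegral_lt_top.ne]
  exact congrArg _ (EReal.coe_ennreal_toReal hi.neg.lintegral_lt_top.ne).symm

theorem tendsto_lintegral_ofReal_neg_max (hf : Measurable f) :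
    Tendsto (fun K : ℕ => ∫⁻ x, ENNReal.ofReal (-max (f x) (-K)) ∂μ) atTop
      (𝓝 (∫⁻ x, ENNReal.ofReal (-f x) ∂μ)) := by
  refine lintegral_tendsto_of_tendsto_of_monotone
    (fun K => ((hf.max measurable_const).neg.ennreal_ofReal).aemeasurable)
    (ae_of_all _ fun x K L hKL => ?_) (ae_of_all _ fun x => ?_)
  · exact ENNReal.ofReal_le_ofReal
      (neg_le_neg (max_le_max le_rfl (neg_le_neg (Nat.cast_le.2 hKL))))
  · obtain ⟨K, hK⟩ := exists_nat_ge (-f x)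
    refine tendsto_const_nhds.congr' ?_
    filter_upwards [eventually_ge_atTop K] with L hL
    rw [max_eq_left (neg_le.1 (hK.trans (Nat.cast_le.2 hL)))]

theorem exists_integral_max_neg_lt [IsFiniteMeasure μ] (hf : Measurable f)
    (hpos : ∫⁻ x, ENNReal.ofReal (f x) ∂μ ≠ ⊤) (hneg : ∫⁻ x, ENNReal.ofReal (-f x) ∂μ = ⊤)
    (a : ℝ) :
    ∃ K : ℕ, Integrable (fun x => max (f x) (-K)) μ ∧ ∫ x, max (f x) (-K) ∂μ < a := by
  have hposK : ∀ K : ℕ, ∫⁻ x, ENNReal.ofReal (max (f x) (-K)) ∂μ =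
      ∫⁻ x, ENNReal.ofReal (f x) ∂μ := fun K => lintegral_congr fun x => by
    rw [ENNReal.ofReal_max, ENNReal.ofReal_of_nonpos (neg_nonpos.2 K.cast_nonneg),
      max_eq_left zero_le]
  have hnegK : ∀ K : ℕ, ∫⁻ x, ENNReal.ofReal (-max (f x) (-K)) ∂μ ≠ ⊤ := fun K => by
    refine ((lintegral_mono (g := fun _ => ENNReal.ofReal K) fun x => ?_).trans_lt ?_).ne
    · exact ENNReal.ofReal_le_ofReal (neg_le.1 (le_max_right _ _))
    · rw [lintegral_const]; finiteness
  have hint : ∀ K : ℕ, Integrable (fun x => max (f x) (-(K : ℝ))) μ := fun K =>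
    integrable_of_lintegral_ofReal_ne_top (hf.max measurable_const) ((hposK K).trans_ne hpos)
      (hnegK K)
  have hlim := tendsto_lintegral_ofReal_neg_max (μ := μ) hf
  rw [hneg] at hlim
  obtain ⟨K, hK⟩ := (hlim.eventually_const_lt (ENNReal.ofReal_lt_top
    (r := (∫⁻ x, ENNReal.ofReal (f x) ∂μ).toReal - a))).exists
  refine ⟨K, hint K, ?_⟩
  rw [← ENNReal.ofReal_toReal (hnegK K)] at hK
  rw [integral_eq_lintegral_pos_part_sub_lintegral_neg_part (hint K), hposK]
  linarith [(ENNReal.ofReal_lt_ofReal_iff'.1 hK).1]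

theorem ae_tendsto_birkhoffAverage_extExpectation [IsProbabilityMeasure μ]
    (hθ : Ergodic θ μ) (hf : Measurable f) (hpos : ∫⁻ x, ENNReal.ofReal (f x) ∂μ ≠ ⊤) :
    ∀ᵐ x ∂μ, Tendsto (fun n => ((birkhoffAverage ℝ θ f n x : ℝ) : EReal)) atTop
      (𝓝 (extExpectation μ f)) := by
  by_cases hneg : ∫⁻ x, ENNReal.ofReal (-f x) ∂μ = ⊤
  · have hlt : ∀ a : ℤ, ∀ᵐ x ∂μ, ∀ᶠ n in atTop, birkhoffAverage ℝ θ f n x < a := fun a => by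
      obtain ⟨K, hint, hK⟩ := exists_integral_max_neg_lt hf hpos hneg a
      filter_upwards [ae_eventually_birkhoffAverage_lt hθ (hf.max measurable_const) hint hK]
        with x hx
      refine hx.mono fun n hn => lt_of_le_of_lt ?_ hn
      exact mul_le_mul_of_nonneg_left (Finset.sum_le_sum fun k _ => le_max_left _ _)
        (inv_nonneg.2 n.cast_nonneg)
    have hbot : extExpectation μ f = ⊥ := by simp [extExpectation, hneg]
    filter_upwards [ae_all_iff.2 hlt] with x hx
    rw [hbot, EReal.tendsto_nhds_bot_iff_real]
    intro a
    obtain ⟨b, hb⟩ := exists_int_lt a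
    exact (hx b).mono fun n hn => EReal.coe_lt_coe (hn.trans hb)
  · have hi := integrable_of_lintegral_ofReal_ne_top hf hpos hneg
    filter_upwards [ae_tendsto_birkhoffAverage hθ hf hi] with x hx
    rw [extExpectation_eq_integral hi]
    exact EReal.tendsto_coe.2 hx

end ErgodicTheorem

theorem measure_eq_tsum_inter_setOf_eq {α E : Type*} [MeasurableSpace α] [Countable E]
    [MeasurableSpace E] [MeasurableSingletonClass E] (μ : Measure α) {f : α → E}
    (hf : Measurable f) (s : Set α) : μ s = ∑' j, μ (s ∩ {x | f x = j}) := by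
  have h := tsum_measure_preimage_singleton (μ := μ.restrict s) Set.countable_univ (f := f)
    fun y _ => hf (measurableSet_singleton y)
  rw [Set.preimage_univ, Measure.restrict_apply_univ,
    tsum_univ (f := fun j => μ.restrict s (f ⁻¹' {j}))] at h
  rw [← h]
  refine tsum_congr fun j => ?_
  rw [Measure.restrict_apply (hf (measurableSet_singleton j)), Set.inter_comm]
  rfl

namespace MarkovAdditiveChain

section Recenter

variable {E : Type*}

/-- The path seen from time `T` on, with the level recentred at its value at time `T`. The shift
`recenter 1` is the measure preserving map to which ergodic theory is applied. -/
def recenter (T : ℕ) (w : ℕ → ℤ × E) : ℕ → ℤ × E :=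
  fun n => ((w (T + n)).1 - (w T).1, (w (T + n)).2)

theorem recenter_recenter (S T : ℕ) (w : ℕ → ℤ × E) :
    recenter S (recenter T w) = recenter (T + S) w := by
  funext n
  simp [recenter, add_assoc]

theorem preimage_recenter_eq_of_invariant {C : Set (ℕ → ℤ × E)} (hC : recenter 1 ⁻¹' C = C)
    {T : ℕ} (hT : 0 < T) : recenter T ⁻¹' C = C := by
  induction T, hT using Nat.le_induction with
  | base => exact hC
  | succ T _ ih =>
    calc recenter (T + 1) ⁻¹' C = recenter T ⁻¹' (recenter 1 ⁻¹' C) := by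
          ext w; simp only [Set.mem_preimage, recenter_recenter]
      _ = C := by rw [hC, ih]

theorem iterate_recenter_apply_fst_sub (k m l : ℕ) (w : ℕ → ℤ × E) :
    ((recenter 1)^[k] w m).1 - ((recenter 1)^[k] w l).1 = (w (k + m)).1 - (w (k + l)).1 := by
  induction k generalizing m l with
  | zero => simp
  | succ k ih =>
    rw [Function.iterate_succ_apply']
    simp only [recenter, sub_sub_sub_cancel_right, ih, ← add_assoc]

theorem birkhoffSum_recenter (n : ℕ) (w : ℕ → ℤ × E) :
    birkhoffSum (recenter 1) (fun w => (((w 1).1 - (w 0).1 : ℤ) : ℝ)) n w =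
      (((w n).1 - (w 0).1 : ℤ) : ℝ) := by
  simp only [birkhoffSum, iterate_recenter_apply_fst_sub, add_zero]
  rw [← Int.cast_sum, Finset.sum_range_sub fun k => (w k).1]

variable [MeasurableSpace E]

theorem measurable_apply_fst (n : ℕ) : Measurable fun w : ℕ → ℤ × E => (w n).1 :=
  (measurable_pi_apply n).fst

theorem measurable_apply_snd (n : ℕ) : Measurable fun w : ℕ → ℤ × E => (w n).2 :=
  (measurable_pi_apply n).snd

theorem measurableSet_fst_eq (n : ℕ) (z : ℤ) : MeasurableSet {w : ℕ → ℤ × E | (w n).1 = z} :=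
  measurable_apply_fst n (measurableSet_singleton z)

theorem measurableSet_snd_eq [MeasurableSingletonClass E] (n : ℕ) (j : E) :
    MeasurableSet {w : ℕ → ℤ × E | (w n).2 = j} :=
  measurable_apply_snd n (measurableSet_singleton j)

theorem measurableSet_apply_eq [MeasurableSingletonClass E] (n : ℕ) (p : ℤ × E) :
    MeasurableSet {w : ℕ → ℤ × E | w n = p} :=
  measurable_pi_apply (X := fun _ => ℤ × E) n (measurableSet_singleton p)

theorem measurable_recenter (T : ℕ) : Measurable (recenter (E := E) T) :=
  measurable_pi_lambda _ fun n =>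
    ((measurable_apply_fst (T + n)).sub (measurable_apply_fst T)).prodMk
      (measurable_apply_snd (T + n))

/-- The σ-algebra generated by the coordinates of a path up to time `T`. -/
@[reducible] def history (E : Type*) [MeasurableSpace E] (T : ℕ) : MeasurableSpace (ℕ → ℤ × E) :=
  ⨆ k ≤ T, MeasurableSpace.comap (fun w => w k) inferInstance

theorem history_mono : Monotone (history E) := fun _ _ h =>
  biSup_mono fun _ hk => hk.trans h

theorem history_le (T : ℕ) : history E T ≤ MeasurableSpace.pi :=
  iSup₂_le fun k _ => (measurable_pi_apply k).comap_le

theorem iSup_history : ⨆ T, history E T = MeasurableSpace.pi := by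
  refine le_antisymm (iSup_le history_le) ?_
  rw [MeasurableSpace.pi]
  exact iSup_le fun k => le_iSup_of_le k (le_iSup₂_of_le k le_rfl le_rfl)

theorem measurable_history_apply {k T : ℕ} (hk : k ≤ T) :
    Measurable[history E T] fun w : ℕ → ℤ × E => w k :=
  measurable_iff_comap_le.2 (le_iSup₂_of_le k hk le_rfl)

end Recenter

variable {Ω E : Type*} [MeasurableSpace Ω] [MeasurableSpace E] (M : MarkovAdditiveChain Ω E)

instance (x : ℤ) (i : E) : IsProbabilityMeasure (M.law x i) := M.isProbabilityMeasure_law x i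

section PathLaw

/-- The path `n ↦ (Xₙ - X₀, Jₙ)` of the chain, with the level recentred at its initial value. -/
def path (ω : Ω) : ℕ → ℤ × E := fun n => (M.X n ω - M.X 0 ω, M.J n ω)

theorem measurable_path : Measurable M.path :=
  measurable_pi_lambda _ fun n =>
    ((M.measurable_X n).sub (M.measurable_X 0)).prodMk (M.measurable_J n)

theorem measurable_history_path (T : ℕ) :
    Measurable[⨆ k ≤ T, MeasurableSpace.comap (fun ω => (M.X k ω, M.J k ω)) inferInstance,
      history E T] M.path := by
  have coordinate : ∀ l ≤ T, Measurable[⨆ k ≤ T, MeasurableSpace.comap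
      (fun ω => (M.X k ω, M.J k ω)) inferInstance] fun ω => (M.X l ω, M.J l ω) := fun l hl =>
    measurable_iff_comap_le.2 (le_iSup₂_of_le l hl le_rfl)
  rw [measurable_iff_comap_le, history, MeasurableSpace.comap_iSup]
  refine iSup_le fun k => ?_
  rw [MeasurableSpace.comap_iSup]
  refine iSup_le fun hk => ?_
  rw [MeasurableSpace.comap_comp, ← measurable_iff_comap_le]
  exact ((coordinate k hk).fst.sub (coordinate 0 (Nat.zero_le _)).fst).prodMk (coordinate k hk).snd

theorem recenter_path (T : ℕ) (ω : Ω) :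
    recenter T (M.path ω) = fun n => (M.X (T + n) ω - M.X T ω, M.J (T + n) ω) := by
  funext n
  simp [recenter, path]

/-- The law of the recentred path of the chain started from phase `i`. -/
noncomputable def pathLaw (i : E) : Measure (ℕ → ℤ × E) := (M.law 0 i).map M.path

instance (i : E) : IsProbabilityMeasure (M.pathLaw i) :=
  Measure.isProbabilityMeasure_map M.measurable_path.aemeasurable

theorem map_path_law (x : ℤ) (i : E) : (M.law x i).map M.path = M.pathLaw i := by
  refine Measure.ext fun C hC => ?_
  have h0 : ∀ᵐ ω ∂M.law x i, M.J 0 ω = i := (M.start x i).mono fun ω h => h.2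
  have h1 : M.law x i {ω | M.J 0 ω = i} = 1 := (prob_compl_eq_zero_iff₀
    (NullMeasurableSet.of_compl (NullMeasurableSet.of_null h0))).1 h0
  have h := M.markov_additive x i 0 i Set.univ C MeasurableSet.univ hC
  rw [Set.univ_inter, h1, one_mul] at h
  simp only [zero_add] at h
  rw [pathLaw, Measure.map_apply M.measurable_path hC, Measure.map_apply M.measurable_path hC]
  refine (measure_congr ?_).trans h
  filter_upwards [h0] with ω hω
  exact propext ⟨fun h' => ⟨hω, h'⟩, fun h' => h'.2⟩

variable {M} in
theorem ae_law_path {i : E} {p : (ℕ → ℤ × E) → Prop} (h : ∀ᵐ w ∂M.pathLaw i, p w) (x : ℤ) :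
    ∀ᵐ ω ∂M.law x i, p (M.path ω) :=
  ae_of_ae_map M.measurable_path.aemeasurable (M.map_path_law x i ▸ h)

theorem ae_pathLaw_start (i : E) : ∀ᵐ w ∂M.pathLaw i, (w 0).1 = 0 := by
  rw [pathLaw, ae_map_iff M.measurable_path.aemeasurable (measurableSet_fst_eq 0 0)]
  exact ae_of_all _ fun ω => sub_self (M.X 0 ω)

theorem P_nonneg (i j : E) : 0 ≤ M.P i j := measureReal_nonneg

variable [MeasurableSingletonClass E]

theorem ofReal_P (i j : E) : ENNReal.ofReal (M.P i j) = M.pathLaw i {w | (w 1).2 = j} := by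
  rw [P, Matrix.of_apply, ofReal_measureReal, pathLaw, Measure.map_apply M.measurable_path
    (measurableSet_snd_eq 1 j)]
  rfl

theorem ofReal_A (d : ℤ) (i j : E) :
    ENNReal.ofReal (M.A d i j) = M.pathLaw i {w | w 1 = (d, j)} := by
  rw [A, Matrix.of_apply, ofReal_measureReal, pathLaw, Measure.map_apply M.measurable_path
    (measurableSet_apply_eq 1 (d, j))]
  refine measure_congr ?_
  filter_upwards [M.start 0 i] with ω hω
  refine propext ?_
  change M.X 1 ω = d ∧ M.J 1 ω = j ↔ (M.X 1 ω - M.X 0 ω, M.J 1 ω) = (d, j)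
  rw [hω.1, sub_zero, Prod.mk.injEq]

theorem tsum_ofReal_A (i j : E) :
    ∑' d : ℤ, ENNReal.ofReal (M.A d i j) = ENNReal.ofReal (M.P i j) := by
  rw [ofReal_P, measure_eq_tsum_inter_setOf_eq (M.pathLaw i) (measurable_apply_fst 1)]
  refine tsum_congr fun d => ?_
  rw [ofReal_A, Set.inter_comm]
  congr 1
  ext w
  exact Prod.ext_iff

theorem exists_A_pos {i j : E} (h : 0 < M.P i j) : ∃ d, 0 < M.A d i j := by
  by_contra! hA
  have h0 := M.tsum_ofReal_A i j
  simp only [ENNReal.ofReal_of_nonpos (hA _), tsum_zero] at h0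
  exact h.not_ge (ENNReal.ofReal_eq_zero.1 h0.symm)

theorem pathLaw_markov (i : E) (T : ℕ) (j : E) {B C : Set (ℕ → ℤ × E)}
    (hB : MeasurableSet[history E T] B) (hC : MeasurableSet C) :
    M.pathLaw i (B ∩ {w | (w T).2 = j} ∩ recenter T ⁻¹' C) =
      M.pathLaw i (B ∩ {w | (w T).2 = j}) * M.pathLaw j C := by
  have hBJ : MeasurableSet (B ∩ {w | (w T).2 = j}) :=
    (history_le T B hB).inter (measurableSet_snd_eq T j)
  have h := M.markov_additive 0 i T j _ C (M.measurable_history_path T hB) hC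
  rw [pathLaw, pathLaw, Measure.map_apply M.measurable_path (hBJ.inter (measurable_recenter T hC)),
    Measure.map_apply M.measurable_path hBJ, Measure.map_apply M.measurable_path hC,
    Set.preimage_inter, ← Set.preimage_comp, show recenter T ∘ M.path = _ from
      funext (M.recenter_path T)]
  exact h

section

variable [Fintype E]

theorem pathLaw_preimage_recenter (i : E) (T : ℕ) {C : Set (ℕ → ℤ × E)} (hC : MeasurableSet C) :
    M.pathLaw i (recenter T ⁻¹' C) = ∑ j, M.pathLaw i {w | (w T).2 = j} * M.pathLaw j C := by
  rw [measure_eq_tsum_inter_setOf_eq (M.pathLaw i) (measurable_apply_snd T), tsum_fintype]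
  refine Finset.sum_congr rfl fun j _ => ?_
  have h := M.pathLaw_markov i T j (B := Set.univ) MeasurableSet.univ hC
  rwa [Set.univ_inter, Set.inter_comm] at h

theorem P_mulVec_one : M.P *ᵥ 1 = 1 := by
  funext i
  have h := M.pathLaw_preimage_recenter i 1 (C := Set.univ) MeasurableSet.univ
  simp only [Set.preimage_univ, measure_univ, mul_one, ← ofReal_P] at h
  rw [← ENNReal.ofReal_sum_of_nonneg fun j _ => M.P_nonneg i j] at h
  rw [mulVec, dotProduct_one, Pi.one_apply, ENNReal.ofReal_eq_one.1 h.symm]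

end

variable {M} [Finite E]

theorem pathLaw_eq_of_invariant (hirr : M.P.IsIrreducible) {C : Set (ℕ → ℤ × E)}
    (hC : MeasurableSet C) (hinv : recenter 1 ⁻¹' C = C) (i j : E) :
    M.pathLaw i C = M.pathLaw j C := by
  have := Fintype.ofFinite E
  have harmonic : M.P *ᵥ (fun i => (M.pathLaw i).real C) = fun i => (M.pathLaw i).real C := by
    funext i
    have h := M.pathLaw_preimage_recenter i 1 hC
    simp only [hinv, ← ofReal_P] at h
    rw [mulVec, dotProduct, measureReal_def, h, ENNReal.toReal_sum fun j _ => by finiteness]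
    exact Finset.sum_congr rfl fun j _ => by
      rw [ENNReal.toReal_mul, ENNReal.toReal_ofReal (M.P_nonneg i j), measureReal_def]
  exact (measureReal_eq_measureReal_iff).1
    (eq_of_le_mulVec_of_isIrreducible hirr M.P_mulVec_one harmonic.ge i j)

theorem indep_history_of_invariant (hirr : M.P.IsIrreducible) {C : Set (ℕ → ℤ × E)}
    (hC : MeasurableSet C) (hinv : recenter 1 ⁻¹' C = C) (i : E) (T : ℕ) :
    ProbabilityTheory.Indep (history E (T + 1)) (MeasurableSpace.generateFrom {C})
      (M.pathLaw i) := by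
  refine ProbabilityTheory.IndepSets.indep (history_le _)
    (MeasurableSpace.generateFrom_le fun t ht => by rwa [Set.mem_singleton_iff.1 ht])
    (@MeasurableSpace.isPiSystem_measurableSet _ (history E (T + 1))) (IsPiSystem.singleton C)
    (@MeasurableSpace.generateFrom_measurableSet _ (history E (T + 1))).symm rfl ?_
  rw [ProbabilityTheory.IndepSets_iff]
  rintro A D hA hD
  have hJ := measurable_apply_snd (E := E) (T + 1)
  rw [Set.mem_singleton_iff.1 hD, measure_eq_tsum_inter_setOf_eq (M.pathLaw i) hJ (A ∩ C),
    measure_eq_tsum_inter_setOf_eq (M.pathLaw i) hJ A, ← ENNReal.tsum_mul_right]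
  refine tsum_congr fun j => ?_
  rw [pathLaw_eq_of_invariant hirr hC hinv i j, ← M.pathLaw_markov i (T + 1) j hA hC,
    preimage_recenter_eq_of_invariant hinv T.succ_pos, Set.inter_right_comm]

-- A shift invariant event is independent of every history, hence of itself.
theorem pathLaw_eq_zero_or_one_of_invariant (hirr : M.P.IsIrreducible) {C : Set (ℕ → ℤ × E)}
    (hC : MeasurableSet C) (hinv : recenter 1 ⁻¹' C = C) (i : E) :
    M.pathLaw i C = 0 ∨ M.pathLaw i C = 1 := by
  have hgen : MeasurableSpace.generateFrom {C} ≤ MeasurableSpace.pi :=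
    MeasurableSpace.generateFrom_le fun t ht => by rwa [Set.mem_singleton_iff.1 ht]
  have h := ProbabilityTheory.indep_iSup_of_monotone (indep_history_of_invariant hirr hC hinv i)
    (fun T => history_le _) hgen (fun S T hST => history_mono (Nat.succ_le_succ hST))
  rw [Monotone.iSup_nat_add history_mono 1, iSup_history] at h
  refine ProbabilityTheory.measure_eq_zero_or_one_of_indepSet_self ?_
  rw [ProbabilityTheory.IndepSet_iff_Indep]
  exact ProbabilityTheory.indep_of_indep_of_le_left h hgen

end PathLaw

section Stationary

variable [Fintype E] {π : E → ℝ}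

/-- The law of the recentred path, started from the phase distribution `π`. -/
noncomputable def mixedLaw (π : E → ℝ) : Measure (ℕ → ℤ × E) :=
  ∑ i, ENNReal.ofReal (π i) • M.pathLaw i

theorem mixedLaw_apply (π : E → ℝ) (C : Set (ℕ → ℤ × E)) :
    M.mixedLaw π C = ∑ i, ENNReal.ofReal (π i) * M.pathLaw i C := by
  simp [mixedLaw]

variable {M}

theorem isProbabilityMeasure_mixedLaw (hπ : IsStationaryDistribution M.P π) :
    IsProbabilityMeasure (M.mixedLaw π) := by
  constructor
  simp only [mixedLaw_apply, measure_univ, mul_one]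
  rw [← ENNReal.ofReal_sum_of_nonneg fun i _ => hπ.nonneg i, hπ.sum_eq_one, ENNReal.ofReal_one]

theorem ae_pathLaw_of_ae_mixedLaw (hirr : M.P.IsIrreducible)
    (hπ : IsStationaryDistribution M.P π) {p : (ℕ → ℤ × E) → Prop}
    (h : ∀ᵐ w ∂M.mixedLaw π, p w) (i : E) : ∀ᵐ w ∂M.pathLaw i, p w := by
  rw [ae_iff, mixedLaw_apply, Finset.sum_eq_zero_iff] at h
  exact (mul_eq_zero.1 (h i (Finset.mem_univ i))).resolve_left
    (ENNReal.ofReal_pos.2 (hπ.pos hirr i)).ne'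

theorem ae_mixedLaw_of_ae_pathLaw {p : (ℕ → ℤ × E) → Prop}
    (h : ∀ i, ∀ᵐ w ∂M.pathLaw i, p w) : ∀ᵐ w ∂M.mixedLaw π, p w := by
  rw [ae_iff, mixedLaw_apply, Finset.sum_eq_zero_iff]
  exact fun i _ => mul_eq_zero_of_right _ (h i)

theorem ae_mixedLaw_start : ∀ᵐ w ∂M.mixedLaw π, (w 0).1 = 0 :=
  ae_mixedLaw_of_ae_pathLaw M.ae_pathLaw_start

variable [MeasurableSingletonClass E]

theorem measurePreserving_recenter (hπ : IsStationaryDistribution M.P π) :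
    MeasurePreserving (recenter 1) (M.mixedLaw π) (M.mixedLaw π) := by
  refine ⟨measurable_recenter 1, Measure.ext fun C hC => ?_⟩
  have stationary : ∀ j, ∑ i, ENNReal.ofReal (π i) * ENNReal.ofReal (M.P i j) =
      ENNReal.ofReal (π j) := by
    intro j
    simp only [← ENNReal.ofReal_mul (hπ.nonneg _)]
    rw [← ENNReal.ofReal_sum_of_nonneg fun i _ => mul_nonneg (hπ.nonneg i) (M.P_nonneg i j)]
    exact congrArg ENNReal.ofReal (congrFun hπ.stationary j)
  calc (M.mixedLaw π).map (recenter 1) C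
      = ∑ i, ∑ j, ENNReal.ofReal (π i) * ENNReal.ofReal (M.P i j) * M.pathLaw j C := by
        rw [Measure.map_apply (measurable_recenter 1) hC, mixedLaw_apply]
        simp only [M.pathLaw_preimage_recenter _ 1 hC, ← ofReal_P, Finset.mul_sum, mul_assoc]
    _ = M.mixedLaw π C := by
        rw [Finset.sum_comm, mixedLaw_apply]
        simp only [← Finset.sum_mul, stationary]

theorem ergodic_recenter (hirr : M.P.IsIrreducible) (hπ : IsStationaryDistribution M.P π) :
    Ergodic (recenter 1) (M.mixedLaw π) := by
  have := isProbabilityMeasure_mixedLaw hπ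
  refine ⟨measurePreserving_recenter hπ, ⟨fun {C} hC hinv => ?_⟩⟩
  obtain ⟨i⟩ := hπ.nonempty
  have hconst : M.mixedLaw π C = M.pathLaw i C := by
    rw [mixedLaw_apply]
    simp only [fun j => pathLaw_eq_of_invariant hirr hC hinv j i]
    rw [← Finset.sum_mul, ← ENNReal.ofReal_sum_of_nonneg fun i _ => hπ.nonneg i,
      hπ.sum_eq_one, ENNReal.ofReal_one, one_mul]
  rw [eventuallyConst_set']
  rcases pathLaw_eq_zero_or_one_of_invariant hirr hC hinv i with h | h
  · left
    rw [ae_eq_empty, hconst, h]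
  · right
    rw [ae_eq_univ_iff_measure_eq hC.nullMeasurableSet, hconst, h, measure_univ]

end Stationary

end MarkovAdditiveChain

section Sequences

theorem exists_forall_lt_of_tendsto_atTop {α : Type*} [LinearOrder α] [NoMaxOrder α] {x : ℕ → α}
    (hx : Tendsto x atTop atTop) : ∃ k, ∀ m > k, x k < x m := by
  obtain ⟨N, hN⟩ := eventually_atTop.1 (hx.eventually (eventually_gt_atTop (x 0)))
  have hfin : {n | x n ≤ x 0}.Finite :=
    (Set.finite_lt_nat N).subset fun n hn => not_le.1 fun h => (hN n h).not_ge hn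
  obtain ⟨k, hk, hmax⟩ := Set.exists_max_image _ id hfin ⟨0, le_rfl⟩
  exact ⟨k, fun m hm => hk.trans_lt (not_le.1 fun h => (hmax m h).not_gt hm)⟩

theorem frequently_lt_of_not_tendsto_atTop {x : ℕ → ℤ} (hx : ¬ Tendsto x atTop atTop)
    (h : ∀ z, ¬ ((∃ᶠ n in atTop, x n = z) ∧ ∀ᶠ n in atTop, z ≤ x n)) (L : ℤ) :
    ∃ᶠ n in atTop, x n < L := by
  by_contra hL
  simp only [not_frequently, not_lt] at hL
  obtain ⟨B, hB⟩ : ∃ B, ¬ ∀ᶠ n in atTop, B ≤ x n := by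
    by_contra! hcon
    exact hx (tendsto_atTop.2 hcon)
  obtain ⟨z, hz, hmax⟩ := Int.exists_greatest_of_bdd (P := fun z => ∀ᶠ n in atTop, z ≤ x n)
    ⟨B, fun z hz => by
      by_contra! hlt
      exact hB (hz.mono fun n hn => hlt.le.trans hn)⟩ ⟨L, hL⟩
  have below : ∃ᶠ n in atTop, ¬ (z + 1 ≤ x n) := fun hge => by
    simp only [not_not] at hge
    have := hmax _ hge
    omega
  exact h z ⟨(below.and_eventually hz).mono fun n hn => by omega, hz⟩

theorem liminf_intCast_eq_bot {x : ℕ → ℤ} (h : ∀ L, ∃ᶠ n in atTop, x n < L) :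
    liminf (fun n => ((x n : ℝ) : EReal)) atTop = ⊥ := by
  rw [EReal.eq_bot_iff_forall_lt]
  intro y
  obtain ⟨L, hL⟩ := exists_int_lt y
  refine (liminf_le_of_frequently_le' (x := ((L : ℝ) : EReal)) ?_).trans_lt
    (by exact_mod_cast hL)
  exact (h L).mono fun n hn => by exact_mod_cast hn.le

theorem limsup_intCast_eq_top {x : ℕ → ℤ} (h : ∀ L, ∃ᶠ n in atTop, L < x n) :
    limsup (fun n => ((x n : ℝ) : EReal)) atTop = ⊤ := by
  rw [EReal.eq_top_iff_forall_lt]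
  intro y
  obtain ⟨L, hL⟩ := exists_int_gt y
  refine LT.lt.trans_le (b := ((L : ℝ) : EReal)) (by exact_mod_cast hL)
    (le_limsup_of_frequently_le' ?_)
  exact (h L).mono fun n hn => by exact_mod_cast hn.le

end Sequences

namespace MarkovAdditiveChain

section PathEvents

variable {E : Type*}

/-- The paths whose level never returns to, or below, its initial value. -/
def staysAbove (E : Type*) : Set (ℕ → ℤ × E) :=
  {w | ∀ m > 0, (w 0).1 < (w m).1}

theorem iterate_recenter_mem_staysAbove {k : ℕ} {w : ℕ → ℤ × E} :
    (recenter 1)^[k] w ∈ staysAbove E ↔ ∀ m > k, (w k).1 < (w m).1 := by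
  have h : ∀ m, ((recenter 1)^[k] w 0).1 < ((recenter 1)^[k] w m).1 ↔
      (w k).1 < (w (k + m)).1 := by
    intro m
    rw [← sub_pos, iterate_recenter_apply_fst_sub, sub_pos, add_zero]
  refine ⟨fun hw m hm => ?_, fun hw m hm => (h m).2 (hw _ (by omega))⟩
  have := (h (m - k)).1 (hw (m - k) (by omega))
  rwa [Nat.add_sub_cancel' hm.le] at this

-- Each time from which the path stays above its current level raises all later levels by one.
theorem add_birkhoffSum_staysAbove_le {w : ℕ → ℤ × E} {L : ℤ} (hL : ∀ n, L ≤ (w n).1) {N m : ℕ}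
    (hm : N ≤ m) :
    L + birkhoffSum (recenter 1) ((staysAbove E).indicator fun _ => 1) N w ≤ ((w m).1 : ℝ) := by
  induction N generalizing m with
  | zero => simpa using hL m
  | succ N ih =>
    rw [birkhoffSum_succ]
    by_cases h : (recenter 1)^[N] w ∈ staysAbove E
    · have hlt : ((w N).1 : ℝ) + 1 ≤ (w m).1 := by
        exact_mod_cast iterate_recenter_mem_staysAbove.1 h m hm
      rw [Set.indicator_of_mem h]
      linarith [ih le_rfl]
    · rw [Set.indicator_of_notMem h, add_zero]
      exact ih (Nat.le_of_succ_le hm)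

theorem tendsto_birkhoffAverage_staysAbove {w : ℕ → ℤ × E} (hw : w ∈ staysAbove E)
    (h : Tendsto (fun n : ℕ => ((w n).1 : ℝ) / n) atTop (𝓝 0)) :
    Tendsto (fun n => birkhoffAverage ℝ (recenter 1)
      ((staysAbove E).indicator fun _ => (1 : ℝ)) n w) atTop (𝓝 0) := by
  have upper : Tendsto (fun n : ℕ => ((w n).1 : ℝ) / n - (w 0).1 / n) atTop (𝓝 0) := by
    simpa using h.sub (tendsto_const_div_atTop_nhds_zero_nat ((w 0).1 : ℝ))
  have initial_le : ∀ n, (w 0).1 ≤ (w n).1 := fun n => by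
    rcases n.eq_zero_or_pos with rfl | hn
    · exact le_rfl
    · exact (hw n hn).le
  refine tendsto_of_tendsto_of_tendsto_of_le_of_le tendsto_const_nhds upper (fun n => ?_)
    fun n => ?_
  · exact smul_nonneg (by positivity) (Finset.sum_nonneg fun k _ =>
      Set.indicator_nonneg (fun _ _ => zero_le_one) _)
  · rw [birkhoffAverage, smul_eq_mul, inv_mul_eq_div, ← sub_div]
    gcongr
    exact le_sub_iff_add_le'.2 (add_birkhoffSum_staysAbove_le initial_le le_rfl)

/-- The paths whose level has lower limit equal to the integer `z`. -/
def levelLiminfEq (E : Type*) (z : ℤ) : Set (ℕ → ℤ × E) :=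
  {w | (∃ᶠ n in atTop, (w n).1 = z) ∧ ∀ᶠ n in atTop, z ≤ (w n).1}

theorem recenter_mem_levelLiminfEq {z : ℤ} {w : ℕ → ℤ × E} :
    recenter 1 w ∈ levelLiminfEq E z ↔ w ∈ levelLiminfEq E (z + (w 1).1) := by
  refine and_congr ?_ ?_
  · conv_rhs => rw [← map_add_atTop_eq_nat 1, frequently_map]
    simp only [recenter, add_comm 1, sub_eq_iff_eq_add]
  · conv_rhs => rw [← map_add_atTop_eq_nat 1, eventually_map]
    simp only [recenter, add_comm 1, le_sub_iff_add_le]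

theorem eq_of_mem_levelLiminfEq {y z : ℤ} {w : ℕ → ℤ × E} (hy : w ∈ levelLiminfEq E y)
    (hz : w ∈ levelLiminfEq E z) : y = z := by
  obtain ⟨n, hn, hn'⟩ := (hy.1.and_eventually hz.2).exists
  obtain ⟨m, hm, hm'⟩ := (hz.1.and_eventually hy.2).exists
  omega

variable [MeasurableSpace E]

theorem measurableSet_staysAbove : MeasurableSet (staysAbove E) := by
  simp only [staysAbove, Set.ofPred_forall]
  exact MeasurableSet.iInter fun m => MeasurableSet.iInter fun _ =>
    measurableSet_lt (measurable_apply_fst 0) (measurable_apply_fst m)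

theorem measurableSet_levelLiminfEq (z : ℤ) : MeasurableSet (levelLiminfEq E z) := by
  have h : levelLiminfEq E z = limsup (fun n => {w | (w n).1 = z}) atTop ∩
      liminf (fun n => {w | z ≤ (w n).1}) atTop := by
    ext w
    simp only [Set.mem_inter_iff, mem_limsup_iff_frequently_mem,
      mem_liminf_iff_eventually_mem]
    rfl
  rw [h]
  exact (MeasurableSet.measurableSet_limsup fun n => measurableSet_fst_eq n z).inter
    (MeasurableSet.measurableSet_liminf fun n =>
      measurableSet_le measurable_const (measurable_apply_fst n))

end PathEvents

variable {Ω E : Type*} [MeasurableSpace Ω] [MeasurableSpace E] {M : MarkovAdditiveChain Ω E}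

section Sublinear

variable [Fintype E] [MeasurableSingletonClass E] {π : E → ℝ}

theorem mixedLaw_staysAbove_eq_zero (hirr : M.P.IsIrreducible)
    (hπ : IsStationaryDistribution M.P π)
    (h : ∀ᵐ w ∂M.mixedLaw π, Tendsto (fun n : ℕ => ((w n).1 : ℝ) / n) atTop (𝓝 0)) :
    M.mixedLaw π (staysAbove E) = 0 := by
  have := isProbabilityMeasure_mixedLaw hπ
  have hm := measurableSet_staysAbove (E := E)
  have frequency := ae_tendsto_birkhoffAverage (ergodic_recenter hirr hπ)
    (measurable_const.indicator hm) ((integrable_const (1 : ℝ)).indicator hm)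
  by_contra hne
  obtain ⟨w, hw, hlim, hfreq⟩ :=
    ((frequently_ae_mem_iff.2 hne).and_eventually (h.and frequency)).exists
  have h0 := tendsto_nhds_unique hfreq (tendsto_birkhoffAverage_staysAbove hw hlim)
  rw [integral_indicator_const (1 : ℝ) hm, smul_eq_mul, mul_one, measureReal_eq_zero_iff] at h0
  exact hne h0

theorem ae_not_tendsto_atTop_of_sublinear (hirr : M.P.IsIrreducible)
    (hπ : IsStationaryDistribution M.P π)
    (h : ∀ᵐ w ∂M.mixedLaw π, Tendsto (fun n : ℕ => ((w n).1 : ℝ) / n) atTop (𝓝 0)) :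
    ∀ᵐ w ∂M.mixedLaw π, ¬ Tendsto (fun n => (w n).1) atTop atTop := by
  have h0 := measure_eq_zero_iff_ae_notMem.1 (mixedLaw_staysAbove_eq_zero hirr hπ h)
  have hall : ∀ᵐ w ∂M.mixedLaw π, ∀ k, (recenter 1)^[k] w ∉ staysAbove E :=
    ae_all_iff.2 fun k =>
      ((measurePreserving_recenter hπ).iterate k).quasiMeasurePreserving.ae h0
  filter_upwards [hall] with w hw htop
  obtain ⟨k, hk⟩ := exists_forall_lt_of_tendsto_atTop htop
  exact hw k (iterate_recenter_mem_staysAbove.2 hk)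

end Sublinear

section Modes

variable (M) in
/-- The probability that, started from phase `p.2`, the recentred level has lower limit `p.1`. -/
noncomputable def liminfMass (p : ℤ × E) : ℝ≥0∞ := M.pathLaw p.2 (levelLiminfEq E p.1)

variable (M) in
/-- The modes at the phase `j`: the levels `z` such that `liminfMass` attains at `(z, j)` its
maximum over all levels and phases. -/
def liminfModes (j : E) : Set ℤ := {z | ∀ p, M.liminfMass p ≤ M.liminfMass (z, j)}

section

variable [Finite E]

theorem tsum_liminfMass_ne_top : ∑' p, M.liminfMass p ≠ ⊤ := by
  have := Fintype.ofFinite E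
  rw [← (Equiv.prodComm E ℤ).tsum_eq, ENNReal.tsum_prod', tsum_fintype]
  refine ENNReal.sum_ne_top.2 fun j _ => ne_top_of_le_ne_top ENNReal.one_ne_top ?_
  refine (tsum_meas_le_meas_iUnion_of_disjoint (M.pathLaw j) measurableSet_levelLiminfEq
    fun y z hyz => ?_).trans prob_le_one
  exact Set.disjoint_left.2 fun w hy hz => hyz (eq_of_mem_levelLiminfEq hy hz)

theorem finite_setOf_le_liminfMass {q : ℤ × E} (hq : M.liminfMass q ≠ 0) :
    {p | M.liminfMass q ≤ M.liminfMass p}.Finite :=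
  ENNReal.finite_const_le_of_tsum_ne_top tsum_liminfMass_ne_top hq

theorem finite_liminfModes {q : ℤ × E} (hq : M.liminfMass q ≠ 0) (j : E) :
    (M.liminfModes j).Finite :=
  Set.Finite.of_finite_image ((finite_setOf_le_liminfMass hq).subset (by
    rintro _ ⟨z, hz, rfl⟩
    exact hz q)) (Prod.mk_left_injective j).injOn

theorem exists_nonempty_liminfModes {q : ℤ × E} (hq : M.liminfMass q ≠ 0) :
    ∃ j, (M.liminfModes j).Nonempty := by
  obtain ⟨p, hp, hmax⟩ := Set.exists_max_image _ M.liminfMass (finite_setOf_le_liminfMass hq)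
    ⟨q, le_refl (M.liminfMass q)⟩
  exact ⟨p.2, p.1, fun r => (le_total (M.liminfMass q) (M.liminfMass r)).elim (hmax r)
    fun h => h.trans hp⟩

end

variable [MeasurableSingletonClass E]

theorem liminfMass_eq_tsum [Countable E] (z : ℤ) (j : E) :
    M.liminfMass (z, j) =
      ∑' p : ℤ × E, M.pathLaw j {w | w 1 = p} * M.liminfMass (z - p.1, p.2) := by
  rw [liminfMass, measure_eq_tsum_inter_setOf_eq (M.pathLaw j)
    (measurable_pi_apply (X := fun _ => ℤ × E) 1)]
  refine tsum_congr fun p => ?_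
  have first_step : {w : ℕ → ℤ × E | w 1 = p} ∩ {w | (w 1).2 = p.2} = {w | w 1 = p} :=
    Set.inter_eq_left.2 fun w (hw : w 1 = p) => congrArg Prod.snd hw
  have markov := M.pathLaw_markov j 1 p.2
    (measurable_history_apply le_rfl (measurableSet_singleton p))
    (measurableSet_levelLiminfEq (z - p.1))
  rw [show (fun w : ℕ → ℤ × E => w 1) ⁻¹' {p} = {w | w 1 = p} from rfl, first_step] at markov
  rw [liminfMass, ← markov, Set.inter_comm]
  congr 1
  ext w
  refine and_congr_right fun (hw : w 1 = p) => ?_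
  rw [Set.mem_preimage, recenter_mem_levelLiminfEq, hw, sub_add_cancel]

theorem sub_mem_liminfModes [Countable E] {z d : ℤ} {j k : E} (hz : z ∈ M.liminfModes j)
    (hd : 0 < M.A d j k) : z - d ∈ M.liminfModes k := by
  have step_pos : M.pathLaw j {w | w 1 = (d, k)} ≠ 0 := by
    rw [← ofReal_A]
    exact (ENNReal.ofReal_pos.2 hd).ne'
  have total : ∑' p : ℤ × E, M.pathLaw j {w | w 1 = p} = 1 := by
    simpa using (measure_eq_tsum_inter_setOf_eq (M.pathLaw j)
      (measurable_pi_apply (X := fun _ => ℤ × E) 1) Set.univ).symm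
  refine fun p => (hz p).trans ?_
  by_contra! hlt
  have hsum := ENNReal.tsum_lt_tsum
    (f := fun p => M.pathLaw j {w | w 1 = p} * M.liminfMass (z - p.1, p.2))
    (g := fun p => M.pathLaw j {w | w 1 = p} * M.liminfMass (z, j))
    (by rw [← liminfMass_eq_tsum]; exact measure_ne_top _ _)
    (fun p => mul_le_mul_right (hz _) _)
    (ENNReal.mul_lt_mul_right step_pos (measure_ne_top _ _) hlt)
  rw [← liminfMass_eq_tsum, ENNReal.tsum_mul_right, total, one_mul] at hsum
  exact hsum.false

variable [Finite E]

theorem nonempty_liminfModes (hirr : M.P.IsIrreducible) {q : ℤ × E} (hq : M.liminfMass q ≠ 0)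
    (j : E) : (M.liminfModes j).Nonempty := by
  refine forall_mem_of_isIrreducible hirr (S := {j | (M.liminfModes j).Nonempty})
    (exists_nonempty_liminfModes hq) ?_ j
  rintro j ⟨z, hz⟩ k hjk
  obtain ⟨d, hd⟩ := M.exists_A_pos hjk
  exact ⟨_, sub_mem_liminfModes hz hd⟩

-- Each step translates the modes at its initial phase into those at its final phase. By
-- irreducibility the widths of all these sets agree, so their maxima are translated too.
theorem exists_eq_sub_of_liminfMass_ne_zero (hirr : M.P.IsIrreducible) {q : ℤ × E}
    (hq : M.liminfMass q ≠ 0) : ∃ g : E → ℤ, ∀ d j k, 0 < M.A d j k → d = g j - g k := by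
  have hne := nonempty_liminfModes hirr hq
  have hfin := finite_liminfModes hq
  set top : E → ℤ := fun j => sSup (M.liminfModes j)
  set bot : E → ℤ := fun j => sInf (M.liminfModes j)
  have le_top : ∀ {d j k}, 0 < M.A d j k → top j - d ≤ top k := fun h =>
    le_csSup (hfin _).bddAbove (sub_mem_liminfModes (Int.csSup_mem (hne _) (hfin _).bddAbove) h)
  have bot_le : ∀ {d j k}, 0 < M.A d j k → bot k ≤ bot j - d := fun h =>
    csInf_le (hfin _).bddBelow (sub_mem_liminfModes (Int.csInf_mem (hne _) (hfin _).bddBelow) h)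
  have width_eq := eq_of_le_of_isIrreducible hirr (W := fun j => top j - bot j) fun j k hjk => by
    obtain ⟨d, hd⟩ := M.exists_A_pos hjk
    linarith [le_top hd, bot_le hd]
  refine ⟨top, fun d j k hd => ?_⟩
  linarith [le_top hd, bot_le hd, width_eq j k]

theorem isDegenerate_of_liminfMass_ne_zero (hirr : M.P.IsIrreducible) {q : ℤ × E}
    (hq : M.liminfMass q ≠ 0) : M.IsDegenerate := by
  obtain ⟨g, hg⟩ := exists_eq_sub_of_liminfMass_ne_zero hirr hq
  refine ⟨fun j => -g j, fun j => ?_⟩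
  have step : ∀ᵐ w ∂M.pathLaw j, ∀ p : ℤ × E, w 1 = p → p.1 = g j - g p.2 := by
    refine ae_all_iff.2 fun p => ?_
    by_cases hp : 0 < M.A p.1 j p.2
    · exact ae_of_all _ fun _ _ => hg _ _ _ hp
    · have h0 := M.ofReal_A p.1 j p.2
      rw [ENNReal.ofReal_of_nonpos (not_lt.1 hp)] at h0
      exact (measure_eq_zero_iff_ae_notMem.1 h0.symm).mono fun w hw h => absurd h hw
  filter_upwards [ae_law_path step 0, M.start 0 j] with ω hω h0
  have hX : M.X 1 ω - M.X 0 ω = g j - g (M.J 1 ω) := hω _ rfl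
  rw [h0.2, hX]
  ring

end Modes

section Reflection

variable (M) in
/-- The chain with the sign of the level reversed. -/
def neg : MarkovAdditiveChain Ω E where
  X n ω := -M.X n ω
  J := M.J
  law x i := M.law (-x) i
  measurable_X n := (M.measurable_X n).neg
  measurable_J := M.measurable_J
  isProbabilityMeasure_law x i := M.isProbabilityMeasure_law (-x) i
  start x i := (M.start (-x) i).mono fun ω h => ⟨by rw [h.1, neg_neg], h.2⟩
  markov_additive x i T j B C hB hC := by
    have hle : (⨆ k ≤ T, MeasurableSpace.comap (fun ω => (-M.X k ω, M.J k ω)) inferInstance) ≤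
        ⨆ k ≤ T, MeasurableSpace.comap (fun ω => (M.X k ω, M.J k ω)) inferInstance := by
      refine iSup₂_mono fun k _ => measurable_iff_comap_le.1 ?_
      exact ((comap_measurable _).fst.neg).prodMk (comap_measurable _).snd
    have hreflect : Measurable fun (w : ℕ → ℤ × E) n => (-(w n).1, (w n).2) :=
      measurable_pi_lambda _ fun n => (measurable_apply_fst n).neg.prodMk (measurable_apply_snd n)
    have h := M.markov_additive (-x) i T j B _ (hle B hB) (hreflect hC)
    simp only [Set.mem_preimage, neg_sub] at h
    simpa only [neg_zero, sub_neg_eq_add, neg_add_eq_sub] using h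

variable (M) in
theorem neg_P : M.neg.P = M.P := by
  ext i j
  simp only [P, neg, neg_zero]

theorem IsDegenerate.of_neg (h : M.neg.IsDegenerate) : M.IsDegenerate := by
  obtain ⟨g, hg⟩ := h
  refine ⟨fun j => -g j, fun i => ?_⟩
  have hi := hg i
  simp only [neg, neg_zero] at hi
  filter_upwards [hi] with ω hω
  linarith

end Reflection

section Oscillation

variable [Fintype E] {π : E → ℝ}

theorem ae_mixedLaw_tendsto_zero_of_ae_law
    (h : ∀ i, ∀ᵐ ω ∂M.law 0 i, Tendsto (fun n : ℕ => (M.X n ω : ℝ) / n) atTop (𝓝 0)) :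
    ∀ᵐ w ∂M.mixedLaw π, Tendsto (fun n : ℕ => ((w n).1 : ℝ) / n) atTop (𝓝 0) := by
  refine ae_mixedLaw_of_ae_pathLaw fun i => ?_
  have hmeas : MeasurableSet
      {w : ℕ → ℤ × E | Tendsto (fun n : ℕ => ((w n).1 : ℝ) / n) atTop (𝓝 0)} :=
    measurableSet_tendsto _ fun n =>
      (Measurable.of_discrete.comp (measurable_apply_fst n)).div_const _
  rw [pathLaw, ae_map_iff M.measurable_path.aemeasurable hmeas]
  filter_upwards [h i, M.start 0 i] with ω hω h0
  simpa only [path, h0.1, sub_zero] using hω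

variable [MeasurableSingletonClass E]

theorem ae_frequently_lt_of_sublinear (hirr : M.P.IsIrreducible)
    (hπ : IsStationaryDistribution M.P π) (hdeg : ¬ M.IsDegenerate)
    (h : ∀ i, ∀ᵐ ω ∂M.law 0 i, Tendsto (fun n : ℕ => (M.X n ω : ℝ) / n) atTop (𝓝 0))
    (x : ℤ) (i : E) : ∀ᵐ ω ∂M.law x i, ∀ L, ∃ᶠ n in atTop, M.X n ω < L := by
  have hlim : ∀ᵐ w ∂M.pathLaw i, ∀ z, w ∉ levelLiminfEq E z :=
    ae_all_iff.2 fun z => measure_eq_zero_iff_ae_notMem.1 (by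
      by_contra hne
      exact hdeg (isDegenerate_of_liminfMass_ne_zero hirr (q := (z, i)) hne))
  have htop := ae_pathLaw_of_ae_mixedLaw hirr hπ
    (ae_not_tendsto_atTop_of_sublinear hirr hπ (ae_mixedLaw_tendsto_zero_of_ae_law h)) i
  filter_upwards [ae_law_path hlim x, ae_law_path htop x] with ω hω hω' L
  refine (frequently_lt_of_not_tendsto_atTop hω' hω (L - M.X 0 ω)).mono fun n hn => ?_
  simp only [path] at hn
  linarith

theorem ae_oscillates_of_sublinear (hirr : M.P.IsIrreducible)
    (hπ : IsStationaryDistribution M.P π) (hdeg : ¬ M.IsDegenerate)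
    (h : ∀ i, ∀ᵐ ω ∂M.law 0 i, Tendsto (fun n : ℕ => (M.X n ω : ℝ) / n) atTop (𝓝 0))
    (x : ℤ) (i : E) : ∀ᵐ ω ∂M.law x i,
      limsup (fun n => ((M.X n ω : ℝ) : EReal)) atTop = ⊤ ∧
      liminf (fun n => ((M.X n ω : ℝ) : EReal)) atTop = ⊥ := by
  have hneg : ∀ i, ∀ᵐ ω ∂M.neg.law 0 i,
      Tendsto (fun n : ℕ => (M.neg.X n ω : ℝ) / n) atTop (𝓝 0) := fun i => by
    simp only [neg, neg_zero, Int.cast_neg, neg_div]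
    exact (h i).mono fun ω hω => neg_zero (G := ℝ) ▸ hω.neg
  have hup := ae_frequently_lt_of_sublinear (M := M.neg) (M.neg_P.symm ▸ hirr) (M.neg_P.symm ▸ hπ)
    (fun h' => hdeg h'.of_neg) hneg (-x) i
  simp only [neg, neg_neg] at hup
  filter_upwards [ae_frequently_lt_of_sublinear hirr hπ hdeg h x i, hup] with ω hlow hup
  exact ⟨limsup_intCast_eq_top fun L => (hup (-L)).mono fun n hn => neg_lt_neg_iff.1 hn,
    liminf_intCast_eq_bot hlow⟩

end Oscillation

end MarkovAdditiveChain

section PowerSeries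

theorem hasSum_slope_tsum_pow {b : ℕ → ℝ} {z : ℝ} (h1 : Summable b)
    (hs : Summable fun m => z ^ m * b m) (hz : z ≠ 1) :
    HasSum (fun m => (∑ l ∈ Finset.range m, z ^ l) * b m)
      (slope (fun z => ∑' m, z ^ m * b m) 1 z) := by
  have h := (hs.hasSum.sub h1.hasSum).div_const (z - 1)
  simp only [slope_def_field, one_pow, one_mul]
  refine h.congr_fun fun m => ?_
  rw [geom_sum_eq hz m]
  ring

variable {b : ℕ → ℝ} {D : Set ℝ}

theorem exists_mem_forall_eventually_le (h1 : 1 ∈ D) :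
    ∃ z₀ ∈ D, (z₀ = 1 ∨ 1 < z₀) ∧ ∀ᶠ z in 𝓝[D] 1, z ≤ z₀ := by
  by_cases h : ∃ z ∈ D, 1 < z
  · obtain ⟨z, hz, hz1⟩ := h
    exact ⟨z, hz, Or.inr hz1, (eventually_le_nhds hz1).filter_mono nhdsWithin_le_nhds⟩
  · push Not at h
    exact ⟨1, h1, Or.inl rfl, eventually_mem_nhdsWithin.mono h⟩

theorem tendsto_tsum_pow (hb : ∀ m, 0 ≤ b m) (h1 : 1 ∈ D) (hD : ∀ z ∈ D, 0 ≤ z)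
    (hs : ∀ z ∈ D, Summable fun m => z ^ m * b m) :
    Tendsto (fun z => ∑' m, z ^ m * b m) (𝓝[D] 1) (𝓝 (∑' m, b m)) := by
  obtain ⟨z₀, hz₀, -, hle⟩ := exists_mem_forall_eventually_le h1
  refine tendsto_tsum_of_dominated_convergence (hs z₀ hz₀) (fun m => ?_) ?_
  · have : Tendsto (fun z : ℝ => z ^ m * b m) (𝓝 1) (𝓝 (1 ^ m * b m)) :=
      Continuous.tendsto (by fun_prop) 1
    rw [one_pow, one_mul] at this
    exact this.mono_left nhdsWithin_le_nhds
  · filter_upwards [hle, self_mem_nhdsWithin] with z hz hzD m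
    rw [Real.norm_of_nonneg (mul_nonneg (pow_nonneg (hD z hzD) m) (hb m))]
    exact mul_le_mul_of_nonneg_right (pow_le_pow_left₀ (hD z hzD) hz m) (hb m)

theorem tendsto_geom_sum_mul (m : ℕ) (c : ℝ) (s : Set ℝ) :
    Tendsto (fun z : ℝ => (∑ l ∈ Finset.range m, z ^ l) * c) (𝓝[s] 1) (𝓝 (m * c)) := by
  have : Tendsto (fun z : ℝ => (∑ l ∈ Finset.range m, z ^ l) * c) (𝓝 1)
      (𝓝 ((∑ l ∈ Finset.range m, (1 : ℝ) ^ l) * c)) := Continuous.tendsto (by fun_prop) 1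
  simp only [one_pow, Finset.sum_const, Finset.card_range, nsmul_eq_mul, mul_one] at this
  exact this.mono_left nhdsWithin_le_nhds

theorem geom_sum_mul_nonneg (hb : ∀ m, 0 ≤ b m) {z : ℝ} (hz : 0 ≤ z) (m : ℕ) :
    0 ≤ (∑ l ∈ Finset.range m, z ^ l) * b m :=
  mul_nonneg (Finset.sum_nonneg fun l _ => pow_nonneg hz l) (hb m)

theorem tendsto_slope_tsum_pow (hb : ∀ m, 0 ≤ b m) (h1 : 1 ∈ D) (hD : ∀ z ∈ D, 0 ≤ z)
    (hs : ∀ z ∈ D, Summable fun m => z ^ m * b m) (hm : Summable fun m : ℕ => m * b m) :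
    Tendsto (slope (fun z => ∑' m, z ^ m * b m) 1) (𝓝[D \ {1}] 1) (𝓝 (∑' m : ℕ, m * b m)) := by
  have hb1 : Summable b := by simpa using hs 1 h1
  obtain ⟨z₀, hz₀, hz₀1, hle⟩ := exists_mem_forall_eventually_le h1
  have hbound : Summable fun m => (∑ l ∈ Finset.range m, z₀ ^ l) * b m := by
    rcases hz₀1 with rfl | h
    · simpa using hm
    · exact (hasSum_slope_tsum_pow hb1 (hs z₀ hz₀) h.ne').summable
  refine Tendsto.congr' (f₁ := fun z => ∑' m, (∑ l ∈ Finset.range m, z ^ l) * b m) ?_ ?_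
  · filter_upwards [self_mem_nhdsWithin] with z hz
    exact (hasSum_slope_tsum_pow hb1 (hs z hz.1) hz.2).tsum_eq
  · refine tendsto_tsum_of_dominated_convergence hbound
      (fun m => tendsto_geom_sum_mul m (b m) _) ?_
    filter_upwards [hle.filter_mono (nhdsWithin_mono _ Set.sdiff_subset), self_mem_nhdsWithin]
      with z hz hzD m
    have hz0 := hD z hzD.1
    rw [Real.norm_of_nonneg (geom_sum_mul_nonneg hb hz0 m)]
    exact mul_le_mul_of_nonneg_right
      (Finset.sum_le_sum fun l _ => pow_le_pow_left₀ hz0 hz l) (hb m)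

theorem tendsto_slope_tsum_pow_atTop (hb : ∀ m, 0 ≤ b m) (h1 : 1 ∈ D) (hD : ∀ z ∈ D, 0 ≤ z)
    (hs : ∀ z ∈ D, Summable fun m => z ^ m * b m) (hm : ¬ Summable fun m : ℕ => m * b m) :
    Tendsto (slope (fun z => ∑' m, z ^ m * b m) 1) (𝓝[D \ {1}] 1) atTop := by
  have hb1 : Summable b := by simpa using hs 1 h1
  rw [not_summable_iff_tendsto_nat_atTop_of_nonneg fun m =>
    mul_nonneg (Nat.cast_nonneg m) (hb m)] at hm
  refine tendsto_atTop.2 fun C => ?_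
  obtain ⟨N, hN⟩ := (hm.eventually (eventually_gt_atTop C)).exists
  have hpartial : Tendsto (fun z : ℝ => ∑ m ∈ Finset.range N, (∑ l ∈ Finset.range m, z ^ l) * b m)
      (𝓝[D \ {1}] 1) (𝓝 (∑ m ∈ Finset.range N, m * b m)) :=
    tendsto_finsetSum _ fun m _ => tendsto_geom_sum_mul m (b m) _
  filter_upwards [hpartial.eventually (lt_mem_nhds hN), self_mem_nhdsWithin] with z hz hzD
  exact hz.le.trans <| sum_le_hasSum _
    (fun m _ => geom_sum_mul_nonneg hb (hD z hzD.1) m)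
    (hasSum_slope_tsum_pow hb1 (hs z hzD.1) hzD.2)

theorem hasExtDerivWithinAt_tsum_pow (hb : ∀ m, 0 ≤ b m) (h1 : 1 ∈ D) (hD : ∀ z ∈ D, 0 ≤ z)
    (hs : ∀ z ∈ D, Summable fun m => z ^ m * b m) :
    HasExtDerivWithinAt (fun z => ∑' m, z ^ m * b m)
      (∑' m : ℕ, (m : ℝ≥0∞) * ENNReal.ofReal (b m) : ℝ≥0∞) D 1 := by
  have hnonneg : ∀ m : ℕ, 0 ≤ m * b m := fun m => mul_nonneg (Nat.cast_nonneg m) (hb m)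
  have hofReal : ∀ m : ℕ, (m : ℝ≥0∞) * ENNReal.ofReal (b m) = ENNReal.ofReal (m * b m) :=
    fun m => by rw [ENNReal.ofReal_mul (Nat.cast_nonneg m), ENNReal.ofReal_natCast]
  simp only [hofReal]
  by_cases hm : Summable fun m : ℕ => m * b m
  · rw [← ENNReal.ofReal_tsum_of_nonneg hnonneg hm, EReal.coe_ennreal_ofReal,
      max_eq_left (tsum_nonneg hnonneg)]
    exact EReal.tendsto_coe.2 (tendsto_slope_tsum_pow hb h1 hD hs hm)
  · have htop : ∑' m : ℕ, ENNReal.ofReal (m * b m) = ⊤ := by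
      by_contra hne
      exact hm <| (ENNReal.summable_toReal hne).congr fun m => ENNReal.toReal_ofReal (hnonneg m)
    rw [htop, EReal.coe_ennreal_top]
    exact EReal.tendsto_coe_nhds_top_iff.2 (tendsto_slope_tsum_pow_atTop hb h1 hD hs hm)

end PowerSeries

section BilinearForm

variable {E : Type*} [Fintype E]

theorem dotProduct_mulVec_le_of_le {x y y' : E → ℝ} {B : Matrix E E ℝ} (hx : 0 ≤ x)
    (hB : ∀ i j, 0 ≤ B i j) (hy : y ≤ y') : x ⬝ᵥ (B *ᵥ y) ≤ x ⬝ᵥ (B *ᵥ y') :=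
  dotProduct_le_dotProduct_of_nonneg_left
    (fun i => dotProduct_le_dotProduct_of_nonneg_left hy (hB i)) hx

theorem dotProduct_mulVec_nonneg {x y : E → ℝ} {B : Matrix E E ℝ} (hx : 0 ≤ x)
    (hB : ∀ i j, 0 ≤ B i j) (hy : 0 ≤ y) : 0 ≤ x ⬝ᵥ (B *ᵥ y) := by
  simpa only [mulVec_zero, dotProduct_zero] using dotProduct_mulVec_le_of_le hx hB hy

theorem hasSum_dotProduct_mulVec {ι : Type*} {B : ι → Matrix E E ℝ} {S : Matrix E E ℝ}
    (h : ∀ i j, HasSum (fun m => B m i j) (S i j)) (x y : E → ℝ) :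
    HasSum (fun m => x ⬝ᵥ (B m *ᵥ y)) (x ⬝ᵥ (S *ᵥ y)) :=
  hasSum_sum fun i _ => (hasSum_sum fun j _ => (h i j).mul_right (y j)).mul_left (x i)

theorem slope_dotProduct_mulVec (f : ℝ → Matrix E E ℝ) (x y : E → ℝ) (a b : ℝ) :
    slope (fun z => x ⬝ᵥ (f z *ᵥ y)) a b = x ⬝ᵥ (slope f a b *ᵥ y) := by
  rw [slope_def_module, slope_def_module, smul_mulVec, dotProduct_smul, sub_mulVec, dotProduct_sub]

theorem tendsto_dotProduct_mulVec_of_tendsto_one {ι : Type*} {l : Filter ι}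
    {S : ι → Matrix E E ℝ} {x : E → ℝ} {v : ι → E → ℝ} {d : EReal} (hx : 0 ≤ x)
    (hS : ∀ᶠ z in l, ∀ i j, 0 ≤ S z i j) (hv : Tendsto v l (𝓝 1))
    (h : Tendsto (fun z => ((x ⬝ᵥ (S z *ᵥ 1) : ℝ) : EReal)) l (𝓝 d)) :
    Tendsto (fun z => ((x ⬝ᵥ (S z *ᵥ v z) : ℝ) : EReal)) l (𝓝 d) := by
  have hscaled : ∀ c : ι → ℝ, Tendsto c l (𝓝 1) →
      Tendsto (fun z => ((x ⬝ᵥ (S z *ᵥ (c z • 1)) : ℝ) : EReal)) l (𝓝 d) := fun c hc => by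
    simp only [mulVec_smul, dotProduct_smul, smul_eq_mul, EReal.coe_mul]
    simpa only [EReal.coe_one, one_mul] using EReal.Tendsto.mul (EReal.tendsto_coe.2 hc) h
      (Or.inl one_ne_zero) (Or.inl one_ne_zero) (Or.inl (EReal.coe_ne_bot 1))
      (Or.inl (EReal.coe_ne_top 1))
  have hdist : Tendsto (fun z => ‖v z - 1‖) l (𝓝 0) := tendsto_iff_norm_sub_tendsto_zero.1 hv
  have habs : ∀ z i, |v z i - 1| ≤ ‖v z - 1‖ := fun z i => norm_le_pi_norm (v z - 1) i
  refine tendsto_of_tendsto_of_tendsto_of_le_of_le'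
    (hscaled (fun z => 1 - ‖v z - 1‖) (by simpa only [sub_zero] using hdist.const_sub 1))
    (hscaled (fun z => 1 + ‖v z - 1‖) (by simpa only [add_zero] using hdist.const_add 1)) ?_ ?_
  all_goals
    filter_upwards [hS] with z hz
    refine EReal.coe_le_coe_iff.2 (dotProduct_mulVec_le_of_le hx hz fun i => ?_)
    have := abs_le.1 (habs z i)
    simp only [Pi.smul_apply, Pi.one_apply, smul_eq_mul, mul_one]
    linarith

end BilinearForm

namespace MarkovAdditiveChain

section GeneratingFunction

variable {Ω E : Type*} [MeasurableSpace Ω] [MeasurableSpace E] (M : MarkovAdditiveChain Ω E)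

theorem A_nonneg (m : ℤ) (i j : E) : 0 ≤ M.A m i j := measureReal_nonneg

theorem F_nonneg {z : ℝ} (hz : 0 ≤ z) (i j : E) : 0 ≤ M.F z i j :=
  tsum_nonneg fun _ => mul_nonneg (zpow_nonneg hz _) (M.A_nonneg _ i j)

/-- The part `∑_{m ≥ 0} z ^ m A_{-m}` of `F(z)` with nonnegative exponents. -/
noncomputable def downPart (z : ℝ) : Matrix E E ℝ :=
  Matrix.of fun i j => ∑' m : ℕ, z ^ m * M.A (-(m : ℤ)) i j

theorem zpow_mul_A_succ (z : ℝ) (m : ℕ) (i j : E) :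
    z ^ (((m + 1 : ℕ) : ℤ) - 1) * M.A (1 - ((m + 1 : ℕ) : ℤ)) i j =
      z ^ m * M.A (-(m : ℤ)) i j := by
  rw [Nat.cast_succ, add_sub_cancel_right, zpow_natCast, sub_add_cancel_right]

variable {M}

theorem mem_domF_iff {z : ℝ} :
    z ∈ M.domF ↔ 0 < z ∧ ∀ i j, Summable fun m : ℕ => z ^ m * M.A (-(m : ℤ)) i j := by
  simp only [domF, Set.mem_ofPred_eq, ← M.zpow_mul_A_succ]
  exact and_congr_right fun _ => forall₂_congr fun i j => (summable_nat_add_iff 1).symm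

theorem F_eq_add_downPart {z : ℝ} (hz : z ∈ M.domF) : M.F z = z⁻¹ • M.A 1 + M.downPart z := by
  ext i j
  rw [F, Matrix.of_apply, (hz.2 i j).tsum_eq_zero_add]
  simp [downPart]

theorem slope_F {z : ℝ} (h1 : 1 ∈ M.domF) (hz : z ∈ M.domF) (hz1 : z ≠ 1) :
    slope M.F 1 z = slope M.downPart 1 z - z⁻¹ • M.A 1 := by
  have hinv : (z - 1)⁻¹ * (z⁻¹ - 1) = -z⁻¹ := by
    field_simp [hz.1.ne', sub_ne_zero.2 hz1]
    ring
  rw [slope_def_module, slope_def_module, F_eq_add_downPart h1, F_eq_add_downPart hz, inv_one,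
    add_sub_add_comm, ← sub_smul, smul_add, smul_smul, hinv, neg_smul, neg_add_eq_sub]

theorem slope_downPart_nonneg {z : ℝ} (h1 : 1 ∈ M.domF) (hz : z ∈ M.domF) (hz1 : z ≠ 1)
    (i j : E) : 0 ≤ slope M.downPart 1 z i j := by
  have h := hasSum_slope_tsum_pow (by simpa only [one_pow, one_mul] using (mem_domF_iff.1 h1).2 i j)
    ((mem_domF_iff.1 hz).2 i j) hz1
  exact h.nonneg fun m => geom_sum_mul_nonneg (fun m => M.A_nonneg (-(m : ℤ)) i j) hz.1.le m

section SkipFree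

variable [MeasurableSingletonClass E]

theorem hasSum_int_A (i j : E) : HasSum (fun d : ℤ => M.A d i j) (M.P i j) := by
  have h := M.tsum_ofReal_A i j
  have hsum := ENNReal.hasSum_toReal (h ▸ ENNReal.ofReal_ne_top)
  rw [← ENNReal.tsum_toReal_eq fun d => ENNReal.ofReal_ne_top, h,
    ENNReal.toReal_ofReal (M.P_nonneg i j)] at hsum
  simpa only [ENNReal.toReal_ofReal (M.A_nonneg _ i j)] using hsum

theorem hasSum_A (hskip : M.IsUpwardSkipFree) (i j : E) :
    HasSum (fun k : ℕ => M.A (1 - (k : ℤ)) i j) (M.P i j) := by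
  have hinj : Function.Injective fun k : ℕ => 1 - (k : ℤ) := fun k l h => by
    simp only at h
    omega
  refine (hinj.hasSum_iff fun d hd => ?_).2 (hasSum_int_A i j)
  rw [hskip d, Matrix.zero_apply]
  by_contra hd2
  exact hd ⟨(1 - d).toNat, by simp only; omega⟩

theorem Ioc_subset_domF (hskip : M.IsUpwardSkipFree) : Set.Ioc 0 1 ⊆ M.domF := fun z hz =>
  mem_domF_iff.2 ⟨hz.1, fun i j => by
    have h := (summable_nat_add_iff 1).2 (hasSum_A hskip i j).summable
    simp only [Nat.cast_succ, sub_add_cancel_right] at h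
    exact h.of_nonneg_of_le (fun m => mul_nonneg (pow_nonneg hz.1.le m) (M.A_nonneg _ i j))
      fun m => mul_le_of_le_one_left (M.A_nonneg _ i j) (pow_le_one₀ hz.1.le hz.2)⟩

theorem one_mem_domF (hskip : M.IsUpwardSkipFree) : (1 : ℝ) ∈ M.domF :=
  Ioc_subset_domF hskip ⟨one_pos, le_rfl⟩

theorem F_one (hskip : M.IsUpwardSkipFree) : M.F 1 = M.P := by
  ext i j
  simpa only [F, Matrix.of_apply, _root_.one_zpow, one_mul] using (hasSum_A hskip i j).tsum_eq

theorem isIrreducible_F (hskip : M.IsUpwardSkipFree) (hirr : M.P.IsIrreducible) {z : ℝ}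
    (hz : z ∈ M.domF) : (M.F z).IsIrreducible := by
  refine isIrreducible_of_pos_imp_pos hirr (M.F_nonneg hz.1.le) fun i j h => ?_
  obtain ⟨k, hk⟩ : ∃ k : ℕ, 0 < M.A (1 - (k : ℤ)) i j := by
    by_contra! hA
    exact h.not_ge ((hasSum_A hskip i j).nonpos hA)
  exact (hz.2 i j).tsum_pos (fun k => mul_nonneg (zpow_nonneg hz.1.le _) (M.A_nonneg _ i j)) k
    (mul_pos (zpow_pos hz.1 _) hk)

theorem tendsto_F (hskip : M.IsUpwardSkipFree) : Tendsto M.F (𝓝[M.domF] 1) (𝓝 M.P) := by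
  have h1 := one_mem_domF hskip
  have hdown : Tendsto M.downPart (𝓝[M.domF] 1) (𝓝 (M.downPart 1)) := by
    refine tendsto_pi_nhds.2 fun i => tendsto_pi_nhds.2 fun j => ?_
    have h := tendsto_tsum_pow (fun m => M.A_nonneg (-(m : ℤ)) i j) h1 (fun z hz => hz.1.le)
      fun z hz => (mem_domF_iff.1 hz).2 i j
    simpa only [downPart, Matrix.of_apply, one_pow, one_mul] using h
  have hinv : Tendsto (fun z : ℝ => z⁻¹) (𝓝[M.domF] 1) (𝓝 1⁻¹) :=
    (tendsto_inv₀ one_ne_zero).mono_left nhdsWithin_le_nhds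
  rw [← F_one hskip, F_eq_add_downPart h1]
  refine ((hinv.smul_const (M.A 1)).add hdown).congr' ?_
  filter_upwards [self_mem_nhdsWithin] with z hz using (F_eq_add_downPart hz).symm

theorem hasExtDerivWithinAt_dotProduct_downPart [Fintype E]
    (hskip : M.IsUpwardSkipFree) {π : E → ℝ} (hπ : 0 ≤ π) :
    HasExtDerivWithinAt (fun z => π ⬝ᵥ (M.downPart z *ᵥ 1)) (M.meanDown π) M.domF 1 := by
  have h1 := one_mem_domF hskip
  have hsum : ∀ z ∈ M.domF, HasSum (fun m : ℕ => z ^ m * (π ⬝ᵥ (M.A (-(m : ℤ)) *ᵥ 1)))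
      (π ⬝ᵥ (M.downPart z *ᵥ 1)) := fun z hz => by
    simpa only [smul_mulVec, dotProduct_smul, smul_eq_mul] using
      hasSum_dotProduct_mulVec (B := fun m : ℕ => z ^ m • M.A (-(m : ℤ))) (S := M.downPart z)
        (fun i j => ((mem_domF_iff.1 hz).2 i j).hasSum) π 1
  refine (hasExtDerivWithinAt_tsum_pow
    (fun m => dotProduct_mulVec_nonneg hπ (M.A_nonneg (-(m : ℤ))) zero_le_one) h1
    (fun z hz => hz.1.le) fun z hz => (hsum z hz).summable).congr' ?_
  filter_upwards [self_mem_nhdsWithin] with z hz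
  rw [slope_def_field, slope_def_field, (hsum z hz.1).tsum_eq, (hsum 1 h1).tsum_eq]

end SkipFree

end GeneratingFunction

section Eigenvalue

variable {Ω E : Type*} [MeasurableSpace Ω] [MeasurableSpace E] [MeasurableSingletonClass E]
  [Fintype E] [DecidableEq E] {M : MarkovAdditiveChain Ω E} {π : E → ℝ}

theorem exists_pos_eigenvector_F (hirr : M.P.IsIrreducible) (hskip : M.IsUpwardSkipFree)
    (hπ : IsStationaryDistribution M.P π) {z : ℝ} (hz : z ∈ M.domF) :
    ∃ v : E → ℝ, (∀ i, 0 < v i) ∧ π ⬝ᵥ v = 1 ∧ M.F z *ᵥ v = M.κ z • v := by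
  have := hπ.nonempty
  have hF := isIrreducible_F hskip hirr hz
  obtain ⟨r, v, hv, h⟩ := exists_pos_eigenvector_of_isIrreducible hF
  have hpos : 0 < π ⬝ᵥ v :=
    Finset.sum_pos (fun i _ => mul_pos (hπ.pos hirr i) (hv i)) Finset.univ_nonempty
  refine ⟨(π ⬝ᵥ v)⁻¹ • v, fun i => mul_pos (inv_pos.2 hpos) (hv i), ?_, ?_⟩
  · rw [dotProduct_smul, smul_eq_mul, inv_mul_cancel₀ hpos.ne']
  · rw [mulVec_smul, h, smul_comm, κ, perronFrobeniusEigenvalue_eq hF.nonneg hv h]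

theorem hasEigenvalue_κ (hirr : M.P.IsIrreducible) (hskip : M.IsUpwardSkipFree)
    (hπ : IsStationaryDistribution M.P π) {z : ℝ} (hz : z ∈ M.domF) :
    Module.End.HasEigenvalue (Matrix.toLin' (M.F z)) (M.κ z) := by
  obtain ⟨v, -, hπv, h⟩ := exists_pos_eigenvector_F hirr hskip hπ hz
  refine Module.End.hasEigenvalue_of_hasEigenvector (x := v) (Module.End.hasEigenvector_iff.2
    ⟨Module.End.mem_eigenspace_iff.2 ((toLin'_apply _ _).trans h), ?_⟩)
  rintro rfl
  exact zero_ne_one ((dotProduct_zero π).symm.trans hπv)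

theorem κ_one [Nonempty E] (hskip : M.IsUpwardSkipFree) : M.κ 1 = 1 := by
  rw [κ, F_one hskip]
  exact perronFrobeniusEigenvalue_eq M.P_nonneg (fun _ => one_pos)
    ((one_smul ℝ (1 : E → ℝ)).symm ▸ M.P_mulVec_one)

theorem slope_κ (hskip : M.IsUpwardSkipFree) (hπ : IsStationaryDistribution M.P π) {z : ℝ}
    {v : E → ℝ} (hπv : π ⬝ᵥ v = 1) (h : M.F z *ᵥ v = M.κ z • v) :
    slope M.κ 1 z = π ⬝ᵥ (slope M.F 1 z *ᵥ v) := by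
  have := hπ.nonempty
  rw [slope_def_module, slope_def_module, κ_one hskip, F_one hskip, smul_mulVec, dotProduct_smul,
    ← hπ.eigenvalue_sub_one_mul h, hπv, mul_one]

theorem hasExtDerivWithinAt_κ (hirr : M.P.IsIrreducible) (hskip : M.IsUpwardSkipFree)
    (hπ : IsStationaryDistribution M.P π) :
    HasExtDerivWithinAt M.κ (M.driftSum π) M.domF 1 := by
  have h1 := one_mem_domF hskip
  choose! v hvpos hπv hv using fun z hz => exists_pos_eigenvector_F hirr hskip hπ (z := z) hz
  have hmem : ∀ᶠ z in 𝓝[M.domF \ {1}] 1, z ∈ M.domF \ {1} := self_mem_nhdsWithin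
  have hv1 : Tendsto v (𝓝[M.domF \ {1}] 1) (𝓝 1) :=
    tendsto_eigenvector hirr M.P_mulVec_one hπ
      ((tendsto_F hskip).mono_left (nhdsWithin_mono _ Set.sdiff_subset))
      (hmem.mono fun z hz i => (hvpos z hz.1 i).le) (hmem.mono fun z hz => hπv z hz.1)
      (hmem.mono fun z hz => hv z hz.1)
  have hdown : Tendsto (fun z => ((π ⬝ᵥ (slope M.downPart 1 z *ᵥ v z) : ℝ) : EReal))
      (𝓝[M.domF \ {1}] 1) (𝓝 (M.meanDown π)) :=
    tendsto_dotProduct_mulVec_of_tendsto_one hπ.nonneg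
      (hmem.mono fun z hz => slope_downPart_nonneg h1 hz.1 hz.2) hv1 <| by
        simpa only [HasExtDerivWithinAt, slope_dotProduct_mulVec] using
          hasExtDerivWithinAt_dotProduct_downPart hskip hπ.nonneg
  have hup : Tendsto (fun z => z⁻¹ * (π ⬝ᵥ (M.A 1 *ᵥ v z))) (𝓝[M.domF \ {1}] 1)
      (𝓝 (M.meanUp π)) := by
    simpa only [meanUp, inv_one, one_mul] using
      ((tendsto_inv₀ (one_ne_zero (α := ℝ))).mono_left nhdsWithin_le_nhds).mul
        (tendsto_dotProduct tendsto_const_nhds (tendsto_mulVec tendsto_const_nhds hv1))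
  refine ((EReal.continuousAt_add (p := (_, _)) (Or.inr (EReal.coe_ne_bot _))
    (Or.inr (EReal.coe_ne_top _))).tendsto.comp
      (hdown.prodMk_nhds (EReal.tendsto_coe.2 hup.neg))).congr' ?_
  filter_upwards [hmem] with z hz
  rw [slope_κ hskip hπ (hπv z hz.1) (hv z hz.1), slope_F h1 hz.1 hz.2, sub_mulVec, dotProduct_sub,
    smul_mulVec, dotProduct_smul, smul_eq_mul, sub_eq_add_neg, EReal.coe_add]
  rfl

end Eigenvalue

end MarkovAdditiveChain

section ExtExpectation

theorem finsetSum_coe_ennreal_sub_coe_ennreal {ι : Type*} (s : Finset ι) (u d : ι → ℝ≥0∞) :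
    ∑ i ∈ s, ((u i : EReal) - (d i : EReal)) =
      ((∑ i ∈ s, u i : ℝ≥0∞) : EReal) - ((∑ i ∈ s, d i : ℝ≥0∞) : EReal) := by
  classical
  induction s using Finset.induction_on with
  | empty => simp
  | insert a s ha ih =>
    rw [Finset.sum_insert ha, Finset.sum_insert ha, Finset.sum_insert ha, ih]
    simp only [EReal.coe_ennreal_add, sub_eq_add_neg]
    rw [EReal.neg_add (Or.inl (EReal.coe_ennreal_ne_bot _)) (Or.inr (EReal.coe_ennreal_ne_bot _)),
      sub_eq_add_neg, add_add_add_comm]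

theorem coe_mul_coe_ennreal_sub_coe_ennreal {p : ℝ} (hp : 0 ≤ p) (u d : ℝ≥0∞) :
    (p : EReal) * ((u : EReal) - (d : EReal)) =
      ((ENNReal.ofReal p * u : ℝ≥0∞) : EReal) - ((ENNReal.ofReal p * d : ℝ≥0∞) : EReal) := by
  rw [sub_eq_add_neg, EReal.left_distrib_of_nonneg_of_ne_top (EReal.coe_nonneg.2 hp)
    (EReal.coe_ne_top p), mul_neg, ← sub_eq_add_neg, EReal.coe_ennreal_mul, EReal.coe_ennreal_mul,
    EReal.coe_ennreal_ofReal, max_eq_left hp]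

variable {α β : Type*} [MeasurableSpace α] [MeasurableSpace β] {μ : Measure α} {f g : α → ℝ}

theorem extExpectation_congr_ae (h : f =ᵐ[μ] g) : extExpectation μ f = extExpectation μ g := by
  rw [extExpectation, extExpectation,
    lintegral_congr_ae (h.mono fun x hx => congrArg ENNReal.ofReal hx),
    lintegral_congr_ae (h.mono fun x hx => congrArg (fun y => ENNReal.ofReal (-y)) hx)]

theorem extExpectation_map {T : α → β} (hT : Measurable T) {f : β → ℝ} (hf : Measurable f) :
    extExpectation (μ.map T) f = extExpectation μ fun x => f (T x) := by
  rw [extExpectation, extExpectation, lintegral_map hf.ennreal_ofReal hT,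
    lintegral_map (f := fun y => ENNReal.ofReal (-f y)) hf.neg.ennreal_ofReal hT]

theorem extExpectation_finsetSum_smul {ι : Type*} (s : Finset ι) (ν : ι → Measure α) {p : ι → ℝ}
    (hp : ∀ i, 0 ≤ p i) (f : α → ℝ) :
    extExpectation (∑ i ∈ s, ENNReal.ofReal (p i) • ν i) f =
      ∑ i ∈ s, (p i : EReal) * extExpectation (ν i) f := by
  simp only [extExpectation, coe_mul_coe_ennreal_sub_coe_ennreal (hp _),
    finsetSum_coe_ennreal_sub_coe_ennreal, lintegral_finsetSum_measure, lintegral_smul_measure,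
    smul_eq_mul]

end ExtExpectation

section Sign

variable (D : ℝ≥0∞) {u : ℝ}

theorem coe_ennreal_sub_coe_neg_iff : (D : EReal) - (u : EReal) < 0 ↔ D < ENNReal.ofReal u := by
  induction D with
  | top => simp
  | coe d =>
    have h : ((d : ℝ≥0∞) : EReal) - (u : EReal) = ((d - u : ℝ) : EReal) := rfl
    rw [h, ENNReal.ofReal, ENNReal.coe_lt_coe, Real.lt_toNNReal_iff_coe_lt, EReal.coe_neg',
      sub_lt_zero]

theorem coe_ennreal_sub_coe_eq_zero_iff (hu : 0 ≤ u) :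
    (D : EReal) - (u : EReal) = 0 ↔ ENNReal.ofReal u = D := by
  induction D with
  | top => simp
  | coe d =>
    have h : ((d : ℝ≥0∞) : EReal) - (u : EReal) = ((d - u : ℝ) : EReal) := rfl
    rw [h, ENNReal.ofReal, ENNReal.coe_inj, ← NNReal.coe_inj, Real.coe_toNNReal u hu,
      EReal.coe_eq_zero, sub_eq_zero, eq_comm]

theorem coe_ennreal_sub_coe_pos_iff (hu : 0 ≤ u) :
    0 < (D : EReal) - (u : EReal) ↔ ENNReal.ofReal u < D := by
  rw [← not_le, ← not_le, le_iff_lt_or_eq, le_iff_lt_or_eq, coe_ennreal_sub_coe_neg_iff D,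
    coe_ennreal_sub_coe_eq_zero_iff D hu, eq_comm (a := D)]

end Sign

section Divergence

variable {x : ℕ → ℤ} {L : EReal}

theorem tendsto_atTop_of_tendsto_div_pos (hL : 0 < L)
    (h : Tendsto (fun n : ℕ => (((x n : ℝ) / (n : ℝ) : ℝ) : EReal)) atTop (𝓝 L)) :
    Tendsto x atTop atTop := by
  obtain ⟨c, hc0, hcL⟩ := EReal.lt_iff_exists_real_btwn.1 hL
  have hc : 0 < c := by exact_mod_cast hc0
  rw [← tendsto_intCast_atTop_iff (R := ℝ)]
  refine tendsto_atTop_mono' _ ?_ (tendsto_natCast_atTop_atTop.const_mul_atTop hc)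
  filter_upwards [h.eventually (lt_mem_nhds hcL), eventually_gt_atTop 0] with n hn hn0
  exact ((lt_div_iff₀ (by exact_mod_cast hn0)).1 (EReal.coe_lt_coe_iff.1 hn)).le

theorem tendsto_atBot_of_tendsto_div_neg (hL : L < 0)
    (h : Tendsto (fun n : ℕ => (((x n : ℝ) / (n : ℝ) : ℝ) : EReal)) atTop (𝓝 L)) :
    Tendsto x atTop atBot := by
  rw [← tendsto_neg_atTop_iff]
  refine tendsto_atTop_of_tendsto_div_pos (L := -L) (EReal.neg_pos.2 hL) ?_
  refine h.neg.congr fun n => ?_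
  rw [← EReal.coe_neg, ← neg_div, Int.cast_neg]

end Divergence

namespace MarkovAdditiveChain

section Drift

variable {Ω E : Type*} [MeasurableSpace Ω] [MeasurableSpace E] [Fintype E]
  {M : MarkovAdditiveChain Ω E} {π : E → ℝ}

theorem meanUp_nonneg (hπ : 0 ≤ π) : 0 ≤ M.meanUp π :=
  dotProduct_mulVec_nonneg hπ (M.A_nonneg 1) zero_le_one

theorem extExpectation_mixedLaw_level (hπ : ∀ i, 0 ≤ π i) :
    extExpectation (M.mixedLaw π) (fun w => ((w 1).1 : ℝ)) = M.meanX₁ π := by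
  have hlevel : Measurable fun w : ℕ → ℤ × E => ((w 1).1 : ℝ) :=
    Measurable.of_discrete.comp (measurable_apply_fst 1)
  rw [mixedLaw, extExpectation_finsetSum_smul _ _ hπ, meanX₁]
  refine Finset.sum_congr rfl fun i _ => ?_
  rw [pathLaw, extExpectation_map M.measurable_path hlevel]
  congr 1
  refine extExpectation_congr_ae ((M.start 0 i).mono fun ω hω => ?_)
  simp only [path, hω.1, sub_zero]

variable [MeasurableSingletonClass E]

theorem mixedLaw_setOf_level_eq (hπ : ∀ i, 0 ≤ π i) (d : ℤ) :
    M.mixedLaw π {w | (w 1).1 = d} = ENNReal.ofReal (π ⬝ᵥ (M.A d *ᵥ 1)) := by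
  have row (i : E) : M.pathLaw i {w | (w 1).1 = d} = ENNReal.ofReal ((M.A d *ᵥ 1) i) := by
    rw [measure_eq_tsum_inter_setOf_eq (M.pathLaw i) (measurable_apply_snd 1), tsum_fintype,
      mulVec, dotProduct_one, ENNReal.ofReal_sum_of_nonneg fun j _ => M.A_nonneg d i j]
    refine Finset.sum_congr rfl fun j _ => ?_
    rw [ofReal_A]
    exact congrArg _ (Set.ext fun w => (Prod.ext_iff (x := w 1) (y := (d, j))).symm)
  have rowSum_nonneg (i : E) : 0 ≤ (M.A d *ᵥ 1) i := by
    rw [mulVec, dotProduct_one]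
    exact Finset.sum_nonneg fun j _ => M.A_nonneg d i j
  rw [mixedLaw_apply, dotProduct, ENNReal.ofReal_sum_of_nonneg fun i _ =>
    mul_nonneg (hπ i) (rowSum_nonneg i)]
  exact Finset.sum_congr rfl fun i _ => by rw [row, ENNReal.ofReal_mul (hπ i)]

theorem lintegral_mixedLaw_level (hπ : ∀ i, 0 ≤ π i) (φ : ℤ → ℝ≥0∞) :
    ∫⁻ w, φ (w 1).1 ∂M.mixedLaw π = ∑' d : ℤ, φ d * ENNReal.ofReal (π ⬝ᵥ (M.A d *ᵥ 1)) := by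
  rw [← lintegral_map .of_discrete (measurable_apply_fst 1), lintegral_countable']
  refine tsum_congr fun d => ?_
  rw [Measure.map_apply (measurable_apply_fst 1) (measurableSet_singleton d),
    ← mixedLaw_setOf_level_eq hπ d]
  rfl

theorem lintegral_mixedLaw_ofReal_level (hskip : M.IsUpwardSkipFree) (hπ : ∀ i, 0 ≤ π i) :
    ∫⁻ w, ENNReal.ofReal ((w 1).1 : ℝ) ∂M.mixedLaw π = ENNReal.ofReal (M.meanUp π) := by
  rw [lintegral_mixedLaw_level hπ fun d => ENNReal.ofReal d, tsum_eq_single 1]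
  · simp [meanUp]
  · intro d hd
    rcases lt_or_gt_of_ne hd with h | h
    · rw [ENNReal.ofReal_of_nonpos (Int.cast_nonpos.2 (Int.lt_add_one_iff.1 h)), zero_mul]
    · rw [hskip d h, zero_mulVec, dotProduct_zero, ENNReal.ofReal_zero, mul_zero]

theorem lintegral_mixedLaw_ofReal_neg_level (hπ : ∀ i, 0 ≤ π i) :
    ∫⁻ w, ENNReal.ofReal (-((w 1).1 : ℝ)) ∂M.mixedLaw π = M.meanDown π := by
  have neg_injective : Function.Injective fun m : ℕ => -(m : ℤ) :=
    neg_injective.comp Nat.cast_injective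
  rw [lintegral_mixedLaw_level hπ fun d => ENNReal.ofReal (-d), meanDown, ← neg_injective.tsum_eq]
  · simp
  · intro d hd
    have hd0 : d ≤ 0 := by
      by_contra! hpos
      exact hd (mul_eq_zero_of_left (ENNReal.ofReal_of_nonpos (by simpa using hpos.le)) _)
    exact ⟨d.natAbs, by simp only; omega⟩

theorem meanX₁_eq_neg_driftSum (hskip : M.IsUpwardSkipFree) (hπ : ∀ i, 0 ≤ π i) :
    M.meanX₁ π = -M.driftSum π := by
  rw [← extExpectation_mixedLaw_level hπ, extExpectation,
    lintegral_mixedLaw_ofReal_level hskip hπ, lintegral_mixedLaw_ofReal_neg_level hπ, driftSum,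
    EReal.neg_sub (Or.inl (EReal.coe_ennreal_ne_bot _)) (Or.inr (EReal.coe_ne_top _)),
    EReal.coe_ennreal_ofReal, max_eq_left (meanUp_nonneg hπ), add_comm, sub_eq_add_neg]

theorem ae_pathLaw_tendsto_level_div (hirr : M.P.IsIrreducible)
    (hπ : IsStationaryDistribution M.P π)
    (hpos : ∫⁻ w, ENNReal.ofReal ((w 1).1 : ℝ) ∂M.mixedLaw π ≠ ⊤) (i : E) :
    ∀ᵐ w ∂M.pathLaw i, Tendsto (fun n : ℕ => ((((w n).1 : ℝ) / (n : ℝ) : ℝ) : EReal)) atTop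
      (𝓝 (M.meanX₁ π)) := by
  have := isProbabilityMeasure_mixedLaw hπ
  set increment : (ℕ → ℤ × E) → ℝ := fun w => (((w 1).1 - (w 0).1 : ℤ) : ℝ)
  have hincrement : Measurable increment :=
    Measurable.of_discrete.comp ((measurable_apply_fst 1).sub (measurable_apply_fst 0))
  have increment_ae_eq : increment =ᵐ[M.mixedLaw π] fun w => ((w 1).1 : ℝ) :=
    ae_mixedLaw_start.mono fun w hw => by simp only [increment, hw, sub_zero]
  have slln := ae_tendsto_birkhoffAverage_extExpectation (ergodic_recenter hirr hπ) hincrement (by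
    rwa [lintegral_congr_ae (increment_ae_eq.mono fun w hw => congrArg ENNReal.ofReal hw)])
  rw [extExpectation_congr_ae increment_ae_eq, extExpectation_mixedLaw_level hπ.nonneg] at slln
  filter_upwards [ae_pathLaw_of_ae_mixedLaw hirr hπ slln i, M.ae_pathLaw_start i] with w hw hw0
  refine hw.congr fun n => ?_
  rw [birkhoffAverage, birkhoffSum_recenter, hw0, sub_zero, smul_eq_mul, div_eq_inv_mul]

theorem ae_tendsto_X_div (hirr : M.P.IsIrreducible) (hskip : M.IsUpwardSkipFree)
    (hπ : IsStationaryDistribution M.P π) (x : ℤ) (i : E) :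
    ∀ᵐ ω ∂M.law x i, Tendsto (fun n : ℕ => (((M.X n ω : ℝ) / (n : ℝ) : ℝ) : EReal)) atTop
      (𝓝 (M.meanX₁ π)) := by
  have hpos : ∫⁻ w, ENNReal.ofReal ((w 1).1 : ℝ) ∂M.mixedLaw π ≠ ⊤ := by
    rw [lintegral_mixedLaw_ofReal_level hskip hπ.nonneg]
    exact ENNReal.ofReal_ne_top
  filter_upwards [ae_law_path (ae_pathLaw_tendsto_level_div hirr hπ hpos i) x] with ω hω
  have initial : Tendsto (fun n : ℕ => (((M.X 0 ω : ℝ) / n : ℝ) : EReal)) atTop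
      (𝓝 ((0 : ℝ) : EReal)) :=
    EReal.tendsto_coe.2 (tendsto_const_nhds.div_atTop tendsto_natCast_atTop_atTop)
  have hsum := (EReal.continuousAt_add (p := (M.meanX₁ π, ((0 : ℝ) : EReal)))
    (Or.inr (EReal.coe_ne_bot 0)) (Or.inr (EReal.coe_ne_top 0))).tendsto.comp
      (hω.prodMk_nhds initial)
  simp only [EReal.coe_zero, add_zero] at hsum
  refine hsum.congr fun n => ?_
  simp only [Function.comp, path]
  rw [← EReal.coe_add, ← add_div, Int.cast_sub, sub_add_cancel]

end Drift

end MarkovAdditiveChain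

theorem mainTheorem10 {Ω E : Type*} [MeasurableSpace Ω] [Fintype E] [DecidableEq E]
    [MeasurableSpace E] [MeasurableSingletonClass E]
    (M : MarkovAdditiveChain Ω E) (hirr : M.P.IsIrreducible) (hskip : M.IsUpwardSkipFree)
    (π : E → ℝ) (hπ : IsStationaryDistribution M.P π) :
    Set.Ioc 0 1 ⊆ M.domF ∧
    (∀ z ∈ M.domF, Module.End.HasEigenvalue (Matrix.toLin' (M.F z)) (M.κ z)) ∧
    ∃ κ' : EReal, HasExtDerivWithinAt M.κ κ' M.domF 1 ∧
      (∀ x i, ∀ᵐ ω ∂(M.law x i),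
        Tendsto (fun n : ℕ => (((M.X n ω : ℝ) / (n : ℝ) : ℝ) : EReal)) atTop (𝓝 (-κ'))) ∧
      -κ' = M.meanX₁ π ∧
      M.meanX₁ π = -M.driftSum π ∧
      (κ' < 0 ↔ M.meanDown π < ENNReal.ofReal (M.meanUp π)) ∧
      (0 < κ' ↔ ENNReal.ofReal (M.meanUp π) < M.meanDown π) ∧
      (κ' = 0 ↔ ENNReal.ofReal (M.meanUp π) = M.meanDown π) ∧
      (κ' < 0 → ∀ x i, ∀ᵐ ω ∂(M.law x i), Tendsto (fun n => M.X n ω) atTop atTop) ∧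
      (0 < κ' → ∀ x i, ∀ᵐ ω ∂(M.law x i), Tendsto (fun n => M.X n ω) atTop atBot) ∧
      (κ' = 0 → ¬ M.IsDegenerate → ∀ x i, ∀ᵐ ω ∂(M.law x i),
        limsup (fun n => (((M.X n ω : ℤ) : ℝ) : EReal)) atTop = ⊤ ∧
        liminf (fun n => (((M.X n ω : ℤ) : ℝ) : EReal)) atTop = ⊥) := by
  have hmean := M.meanX₁_eq_neg_driftSum hskip hπ.nonneg
  have hslln := M.ae_tendsto_X_div hirr hskip hπ
  have hup := M.meanUp_nonneg hπ.nonneg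
  rw [hmean] at hslln
  refine ⟨M.Ioc_subset_domF hskip, fun z hz => M.hasEigenvalue_κ hirr hskip hπ hz, M.driftSum π,
    M.hasExtDerivWithinAt_κ hirr hskip hπ, hslln, hmean.symm, hmean,
    coe_ennreal_sub_coe_neg_iff _, coe_ennreal_sub_coe_pos_iff _ hup,
    coe_ennreal_sub_coe_eq_zero_iff _ hup, fun h x i => ?_, fun h x i => ?_,
    fun h hdeg => ?_⟩
  · filter_upwards [hslln x i] with ω hω
    exact tendsto_atTop_of_tendsto_div_pos (EReal.neg_pos.2 h) hω
  · filter_upwards [hslln x i] with ω hω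
    exact tendsto_atBot_of_tendsto_div_neg (EReal.neg_lt_zero.2 h) hω
  · rw [h, neg_zero] at hslln
    exact M.ae_oscillates_of_sublinear hirr hπ hdeg fun i =>
      (hslln 0 i).mono fun ω hω => EReal.tendsto_coe.1 hω
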